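/- **Theorem (Deformed quasi-Nambu–Goldstone theorem).** *Setting.* Let $G$ be a group acting on-site by unitaries $U_g$ on a finite-dimensional prototype spin $\mathbb C^p$, let $\psi\in\mathbb C^p$, and let $q$ be a complex linear combination of hermitian generators (hermitian $Q$ such that $e^{i\theta Q}\in U(G)$ for all $\theta\in\mathbb R$), e.g. a ladder operator. Let $\hat W_N$ be the periodic matrix-product operator on $N$ sites, from prototype spins $\mathbb C^p$ to physical spins $\mathbb C^d$, given by a tensor $W$ of bond dimension $\chi$. Put $A=W|\psi\rangle$, $B=W|q\psi\rangle$, and for tensors $X,Y$ let $T_{XY}=\sum_{l}\overline{X^l}\otimes Y^l$. Assume that the matrix-product state with tensor $A$ is injective (products of $L$ of the matrices $A^l$ span all $\chi\times\chi$ matrices for some $L\ge1$) and that its transfer matrix is normalized and has a unique dominant eigenvalue and no nontrivial Jordan blocks: $$T_{AA}=|R)(L|+\sum_{n=1}^{\chi^2-1}\lambda_n|r_n)(l_n|,\qquad |\lambda_n|<1,$$ with biorthonormal right and left eigenvectors. Let $h$ be a hermitian operator on $m+1$ physical sites and $H_N=\sum_{i=1}^N h_{[i,\dots,i+m]}$ the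 translation-invariant Hamiltonian on the periodic $N$-site chain. Assume that the deformed symmetric space is a degenerate scar space: for all $N>m$, $H_N$ acts as a real scalar $E_0(N)$ on $\operatorname{span}\{\hat W_N U_g^{\otimes N}\psi^{\otimes N}: g\in G\}$. For a nonzero crystal momentum $k$ of the $N$-site chain ($k=2\pi n/N$, $n\in\mathbb Z$, $N\nmid n$) let $$|\tilde k\rangle_N=\frac1{\mathcal N(N,k)}\sum_j e^{ikj}\,\hat W_N q_j\,\psi^{\otimes N},$$ where $\mathcal N(N,k)$ is the norm of the sum, and let $\varepsilon(N,k)=\langle\tilde k|H_N|\tilde k\rangle-E_0(N)$ and $\delta\varepsilon^2(N,k)=\langle\tilde k|H_N^2|\tilde k\rangle-\langle\tilde k|H_N|\tilde k\rangle^2$. Define, for $k\in\mathbb R$, $$\mathcal N_d(k)^2=(L|T_{BB}|R)-(L|T_{BA}|R)(L|T_{AB}|R)+\sum_{n=1}^{\chi^2-1}\left[\frac{(L|T_{BA}|r_n)(l_n|T_{AB}|R)}{e^{-ik}-\lambda_n}+\frac{(L|T_{AB}|r_n)(l_n|T_{BA}|R)}{e^{ik}-\lambda_n}\right].$$ *Conclusion.*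 In the following, $k_N$ is any sequence such that $k_N$ is a nonzero crystal momentum of the $N$-site chain for all large $N$ and $k_N\to k\in\mathbb R$. 1. $\mathcal N_d^2$ is continuous, real and nonnegative, and $\mathcal N(N,k_N)/\sqrt N\to\mathcal N_d(k)$ as $N\to\infty$, for every $k$. 2. There are functions $\varepsilon_k$, $\delta\varepsilon_k^2$ of $k$, continuous on $\{k\in\mathbb R:\mathcal N_d(k)\ne0\}$, such that for every $k$ in this set $\varepsilon(N,k_N)\to\varepsilon_k$ and $\delta\varepsilon^2(N,k_N)\to\delta\varepsilon^2_k$ as $N\to\infty$. 3. If $\mathcal N_d(0)\neq0$, then $\varepsilon_k\to0$ and $\delta\varepsilon^2_k\to0$ as $k\to0$. -/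

import Mathlib

open Filter Topology
open scoped Kronecker

noncomputable section

namespace DeformedScar

/-- The site at distance `a` to the right of `i` on the periodic chain with `N` sites. -/
def siteAdd {N : ℕ} (i : Fin N) (a : ℕ) : Fin N :=
  ⟨(i.val + a) % N, Nat.mod_lt _ (Nat.lt_of_le_of_lt (Nat.zero_le _) i.isLt)⟩

/-- The product state `ψ ⊗ ⋯ ⊗ ψ` on `N` sites, in the computational basis. -/
def productState {p : ℕ} (N : ℕ) (ψ : Fin p → ℂ) : (Fin N → Fin p) → ℂ :=
  fun s => ∏ i, ψ (s i)

/-- The onsite action `M ⊗ ⋯ ⊗ M` on `N` sites. -/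
def onsiteAction {p : ℕ} (N : ℕ) (M : Matrix (Fin p) (Fin p) ℂ) :
    Matrix (Fin N → Fin p) (Fin N → Fin p) ℂ :=
  Matrix.of fun s t => ∏ i, M (s i) (t i)

/-- The operator `q_j`: `q` acting on site `j`, the identity on all other sites. -/
def siteOp {p : ℕ} (N : ℕ) (q : Matrix (Fin p) (Fin p) ℂ) (j : Fin N) :
    Matrix (Fin N → Fin p) (Fin N → Fin p) ℂ :=
  open Classical in
  Matrix.of fun s t => if ∀ i, i ≠ j → s i = t i then q (s j) (t j) else 0

/-- The operator `h_{[i,…,i+m]}`: `h` acting on the `m + 1` consecutive sites starting at `i`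
(periodic boundary conditions), the identity on all other sites. It is used for `m < N`. -/
def blockOp {d m : ℕ} (N : ℕ) (h : Matrix (Fin (m + 1) → Fin d) (Fin (m + 1) → Fin d) ℂ)
    (i : Fin N) : Matrix (Fin N → Fin d) (Fin N → Fin d) ℂ :=
  open Classical in
  Matrix.of fun s t =>
    if ∀ x, (∀ a : Fin (m + 1), x ≠ siteAdd i a) → s x = t x then
      h (fun a => s (siteAdd i a)) (fun a => t (siteAdd i a))
    else 0

/-- The translation invariant local Hamiltonian `H = ∑ i, h_{[i,…,i+m]}` on the periodic chain. -/
def hamiltonian {d m : ℕ} (N : ℕ) (h : Matrix (Fin (m + 1) → Fin d) (Fin (m + 1) → Fin d) ℂ) :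
    Matrix (Fin N → Fin d) (Fin N → Fin d) ℂ :=
  ∑ i : Fin N, blockOp N h i

/-- The matrix-product operator with periodic boundary conditions and tensor `W`: `W l s` is the
bond matrix for the physical index `l` and the prototype index `s`. -/
def mpo {χ d p : ℕ} (N : ℕ) (W : Fin d → Fin p → Matrix (Fin χ) (Fin χ) ℂ) :
    Matrix (Fin N → Fin d) (Fin N → Fin p) ℂ :=
  Matrix.of fun l s => (List.ofFn fun i : Fin N => W (l i) (s i)).prod.trace

/-- The matrix-product-state tensor `W|ψ⟩`. -/
def mpsTensor {χ d p : ℕ} (W : Fin d → Fin p → Matrix (Fin χ) (Fin χ) ℂ) (ψ : Fin p → ℂ) :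
    Fin d → Matrix (Fin χ) (Fin χ) ℂ :=
  fun l => ∑ s, ψ s • W l s

/-- Injectivity of a matrix-product state (possibly after blocking finitely many sites): the
products of `L` matrices of the tensor span the whole matrix algebra, for some `L ≥ 1`. -/
def IsInjectiveMPS {χ d : ℕ} (A : Fin d → Matrix (Fin χ) (Fin χ) ℂ) : Prop :=
  ∃ L : ℕ, 0 < L ∧
    Submodule.span ℂ (Set.range fun s : Fin L → Fin d =>
      (List.ofFn fun i : Fin L => A (s i)).prod) = ⊤

/-- The (mixed) transfer matrix `X^* ⊗ Y` with bra tensor `X` and ket tensor `Y`, the physical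
index being contracted. -/
def transfer {χ d : ℕ} (X Y : Fin d → Matrix (Fin χ) (Fin χ) ℂ) :
    Matrix (Fin χ × Fin χ) (Fin χ × Fin χ) ℂ :=
  ∑ l, (X l).map (starRingEnd ℂ) ⊗ₖ (Y l)

/-- A spectral resolution `E = |R)(L| + ∑ n ≠ top, λ n |r n)(l n|` with biorthonormal eigenvectors
and `|λ n| < 1`: the matrix `E` has no nontrivial Jordan block, and its only dominant eigenvalue
is `1`, which is nondegenerate. -/
structure DominantResolution {ι : Type*} [Fintype ι] [DecidableEq ι] (E : Matrix ι ι ℂ) where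
  /-- The label of the dominant eigenvalue. -/
  top : ι
  /-- The eigenvalues, listed with multiplicity. -/
  ev : ι → ℂ
  /-- The right eigenvectors. -/
  right : ι → ι → ℂ
  /-- The left eigenvectors. -/
  left : ι → ι → ℂ
  biorthonormal : ∀ n n', left n ⬝ᵥ right n' = if n = n' then 1 else 0
  resolution : E = ∑ n, ev n • Matrix.vecMulVec (right n) (left n)
  ev_top : ev top = 1
  norm_ev_lt_one : ∀ n, n ≠ top → ‖ev n‖ < 1

/-- The tensor contraction `(l n| T |r n')`. -/
def DominantResolution.contract {ι : Type*} [Fintype ι] [DecidableEq ι] {E : Matrix ι ι ℂ}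
    (R : DominantResolution E) (n : ι) (T : Matrix ι ι ℂ) (n' : ι) : ℂ :=
  R.left n ⬝ᵥ (T.mulVec (R.right n'))

/-- The hermitian generators of the group of onsite symmetries `U g`: hermitian `Q` such that all
`exp (i θ Q)`, `θ` real, belong to the group. -/
def IsGenerator {G : Type*} [Group G] {p : ℕ} (U : G →* Matrix.unitaryGroup (Fin p) ℂ)
    (Q : Matrix (Fin p) (Fin p) ℂ) : Prop :=
  Q.IsHermitian ∧
    ∀ θ : ℝ, ∃ g, (U g : Matrix (Fin p) (Fin p) ℂ) = NormedSpace.exp ((Complex.I * θ) • Q)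

/-- The complexified Lie algebra of the onsite symmetry action; it contains the ladder operators. -/
def complexLieAlgebra {G : Type*} [Group G] {p : ℕ} (U : G →* Matrix.unitaryGroup (Fin p) ℂ) :
    Submodule ℂ (Matrix (Fin p) (Fin p) ℂ) :=
  Submodule.span ℂ {Q | IsGenerator U Q}

/-- The deformed symmetric space `span {Ŵ U_g^{⊗N} ψ^{⊗N} | g ∈ G}` on `N` sites. -/
def deformedSpace {G : Type*} [Group G] {χ d p : ℕ} (N : ℕ)
    (W : Fin d → Fin p → Matrix (Fin χ) (Fin χ) ℂ) (U : G →* Matrix.unitaryGroup (Fin p) ℂ)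
    (ψ : Fin p → ℂ) : Submodule ℂ ((Fin N → Fin d) → ℂ) :=
  Submodule.span ℂ (Set.range fun g : G =>
    (mpo N W).mulVec
      ((onsiteAction N (U g : Matrix (Fin p) (Fin p) ℂ)).mulVec (productState N ψ)))

/-- The twisted state before normalization, `∑ j, e^{ikj} Ŵ q_j ψ^{⊗N}`. -/
def twistedVec {χ d p : ℕ} (N : ℕ) (W : Fin d → Fin p → Matrix (Fin χ) (Fin χ) ℂ)
    (ψ : Fin p → ℂ) (q : Matrix (Fin p) (Fin p) ℂ) (k : ℝ) : (Fin N → Fin d) → ℂ :=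
  ∑ j : Fin N, Complex.exp (Complex.I * k * (j.val : ℂ)) •
    (mpo N W).mulVec ((siteOp N q j).mulVec (productState N ψ))

/-- The normalization factor: the Hilbert space norm of the twisted vector. -/
def normalization {χ d p : ℕ} (N : ℕ) (W : Fin d → Fin p → Matrix (Fin χ) (Fin χ) ℂ)
    (ψ : Fin p → ℂ) (q : Matrix (Fin p) (Fin p) ℂ) (k : ℝ) : ℝ :=
  Real.sqrt (star (twistedVec N W ψ q k) ⬝ᵥ twistedVec N W ψ q k).re

/-- The normalized twisted state `|k̃⟩`. -/
def twistedState {χ d p : ℕ} (N : ℕ) (W : Fin d → Fin p → Matrix (Fin χ) (Fin χ) ℂ)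
    (ψ : Fin p → ℂ) (q : Matrix (Fin p) (Fin p) ℂ) (k : ℝ) : (Fin N → Fin d) → ℂ :=
  ((normalization N W ψ q k : ℂ))⁻¹ • twistedVec N W ψ q k

/-- The expectation value `⟨v|O|v⟩` of a hermitian operator. -/
def expectation {ι : Type*} [Fintype ι] (O : Matrix ι ι ℂ) (v : ι → ℂ) : ℝ :=
  (star v ⬝ᵥ O.mulVec v).re

/-- The energy variance `⟨v|H²|v⟩ - ⟨v|H|v⟩²`. -/
def energyVariance {ι : Type*} [Fintype ι] (H : Matrix ι ι ℂ) (v : ι → ℂ) : ℝ :=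
  expectation (H * H) v - expectation H v ^ 2

/-- The nonzero crystal momenta `2πn/N` (`n` not divisible by `N`) of a periodic chain with `N`
sites. -/
def momenta (N : ℕ) : Set ℝ :=
  {k | ∃ n : ℤ, ¬ (N : ℤ) ∣ n ∧ k = 2 * Real.pi * n / N}

/-- The squared normalization per site `𝒩_d(k)²` as a finite tensor contraction, for the
tensors `A = W|ψ⟩` and `B = W q|ψ⟩`. -/
def normDensitySq {χ d : ℕ} (A B : Fin d → Matrix (Fin χ) (Fin χ) ℂ)
    (R : DominantResolution (transfer A A)) (k : ℝ) : ℂ :=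
  R.contract R.top (transfer B B) R.top
    - R.contract R.top (transfer B A) R.top * R.contract R.top (transfer A B) R.top
    + ∑ n ∈ Finset.univ.erase R.top,
        (R.contract R.top (transfer B A) n * R.contract n (transfer A B) R.top
            / (Complex.exp (-(Complex.I * k)) - R.ev n)
          + R.contract R.top (transfer A B) n * R.contract n (transfer B A) R.top
            / (Complex.exp (Complex.I * k) - R.ev n))

end DeformedScar

end

/-!
All quantities are overlaps of Fourier superpositions `∑ j, exp (i k j) X_j`, where `X_j` is the
matrix-product state `|A⟩` with a fixed block inserted at site `j`. Translation invariance and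
`exp (i k N) = 1` turn such an overlap into `N` times a Fourier sum over the distance of the two
insertions. Each term of this sum converges to a tensor contraction, and it approaches its
disconnected part exponentially fast in the distance. The disconnected part is constant, so it drops
out for `k ≠ 0`, and the rest converges by dominated convergence to a continuous function of `k`.
For the site insertions `W|qψ⟩` the limit is a sum of geometric series, which is `𝒩_d(k)²`.

Injectivity provides a local operator `O` with `X_j = O_j |A⟩`. As `|A⟩` is an eigenstate of `H`,
one has `(H - E₀) X_j = [H, O_j] |A⟩`, and `[H, O_j]` is again local. Thus energy and variance are
quotients of overlaps of the above type. Differentiating `U_g` shows that the sum of all `X_j`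
(`k = 0`) lies in the deformed symmetric space, where `H - E₀` vanishes; hence both tend to `0` as
`k → 0`.
-/

noncomputable section

namespace DeformedScar

open scoped Matrix

section Extend

variable {α ι κ μ : Type*}

theorem extend_extend_self {f : ι → κ} (hf : f.Injective) (t u : ι → α) (s : κ → α) :
    Function.extend f t (Function.extend f u s) = Function.extend f t s := by
  funext x
  by_cases hx : ∃ a, f a = x
  · obtain ⟨a, rfl⟩ := hx
    simp only [hf.extend_apply]
  · simp only [Function.extend_apply' _ _ _ hx]

theorem extend_extend_comm {f : ι → κ} {g : μ → κ} (hf : f.Injective) (hg : g.Injective)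
    (hfg : ∀ a b, f a ≠ g b) (t : ι → α) (u : μ → α) (s : κ → α) :
    Function.extend f t (Function.extend g u s) = Function.extend g u (Function.extend f t s) := by
  funext x
  by_cases hx : ∃ a, f a = x
  · obtain ⟨a, rfl⟩ := hx
    have hfa : ¬ ∃ b, g b = f a := fun ⟨b, hb⟩ => hfg a b hb.symm
    simp only [hf.extend_apply, Function.extend_apply' _ _ _ hfa]
  · by_cases hy : ∃ b, g b = x
    · obtain ⟨b, rfl⟩ := hy
      simp only [hg.extend_apply, Function.extend_apply' _ _ _ hx]
    · simp only [Function.extend_apply' _ _ _ hx, Function.extend_apply' _ _ _ hy]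

theorem extend_comp_of_disjoint {f : ι → κ} {g : μ → κ} (hfg : ∀ a b, f a ≠ g b) (t : ι → α)
    (s : κ → α) : Function.extend f t s ∘ g = s ∘ g :=
  funext fun b => Function.extend_apply' _ _ _ fun ⟨a, ha⟩ => hfg a b ha

end Extend

section LocalOperators

variable {R α ι κ μ : Type*}

/-- The operator `Z` acting on the sites in the range of `f`, the identity on all other sites. It
is used for injective `f`. -/
def localOp [Zero R] (f : ι → κ) (Z : Matrix (ι → α) (ι → α) R) : Matrix (κ → α) (κ → α) R :=
  open Classical in
  Matrix.of fun s t => if ∀ x, (∀ a, x ≠ f a) → s x = t x then Z (s ∘ f) (t ∘ f) else 0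

theorem localOp_sub [AddGroup R] (f : ι → κ) (X Y : Matrix (ι → α) (ι → α) R) :
    localOp f (X - Y) = localOp f X - localOp f Y := by
  ext s t
  simp only [localOp, Matrix.of_apply, Matrix.sub_apply]
  split_ifs
  exacts [rfl, (sub_zero 0).symm]

theorem localOp_sum [AddCommMonoid R] {β : Type*} (f : ι → κ) (S : Finset β)
    (X : β → Matrix (ι → α) (ι → α) R) :
    localOp f (∑ b ∈ S, X b) = ∑ b ∈ S, localOp f (X b) := by
  ext s t
  simp only [localOp, Matrix.of_apply, Matrix.sum_apply]
  split_ifs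
  exacts [rfl, Finset.sum_const_zero.symm]

theorem isHermitian_localOp [AddMonoid R] [StarAddMonoid R] (f : ι → κ)
    {Z : Matrix (ι → α) (ι → α) R} (hZ : Z.IsHermitian) : (localOp f Z).IsHermitian := by
  ext s t
  have hcomm : (∀ x, (∀ a, x ≠ f a) → t x = s x) ↔ ∀ x, (∀ a, x ≠ f a) → s x = t x :=
    forall₂_congr fun _ _ => eq_comm
  rw [Matrix.conjTranspose_apply, localOp, Matrix.of_apply, Matrix.of_apply]
  by_cases hst : ∀ x, (∀ a, x ≠ f a) → s x = t x
  · rw [if_pos hst, if_pos (hcomm.2 hst), hZ.apply]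
  · rw [if_neg hst, if_neg (hcomm.not.2 hst), star_zero]

variable [CommSemiring R] [Fintype α] [Fintype κ] [DecidableEq κ]

theorem localOp_mulVec_apply [Fintype ι] [DecidableEq ι] {f : ι → κ} (hf : f.Injective)
    (Z : Matrix (ι → α) (ι → α) R) (v : (κ → α) → R) (s : κ → α) :
    (localOp f Z *ᵥ v) s = ∑ t, Z (s ∘ f) t * v (Function.extend f t s) := by
  rw [Matrix.mulVec, dotProduct]
  refine (Fintype.sum_of_injective (fun t => Function.extend f t s)
    (Function.extend_injective hf s) _ _ (fun t ht => ?_) fun t => ?_).symm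
  · rw [localOp, Matrix.of_apply, if_neg, zero_mul]
    intro hst
    refine ht ⟨t ∘ f, funext fun x => ?_⟩
    by_cases hx : ∃ a, f a = x
    · obtain ⟨a, rfl⟩ := hx
      exact hf.extend_apply _ _ _
    · exact (Function.extend_apply' _ _ _ hx).trans (hst x fun a ha => hx ⟨a, ha.symm⟩)
  · rw [localOp, Matrix.of_apply, if_pos, Function.extend_comp hf]
    intro x hx
    rw [Function.extend_apply']
    rintro ⟨a, rfl⟩
    exact hx a rfl

theorem localOp_mul_mulVec [Fintype ι] [DecidableEq ι] {f : ι → κ} (hf : f.Injective)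
    (X Y : Matrix (ι → α) (ι → α) R) (v : (κ → α) → R) :
    localOp f (X * Y) *ᵥ v = localOp f X *ᵥ (localOp f Y *ᵥ v) := by
  funext s
  simp only [localOp_mulVec_apply hf, Function.extend_comp hf, extend_extend_self hf,
    Matrix.mul_apply, Finset.sum_mul, Finset.mul_sum, mul_assoc]
  exact Finset.sum_comm

theorem localOp_localOp_mulVec {f : ι → μ} {g : μ → κ} (hf : f.Injective) (hg : g.Injective)
    (Z : Matrix (ι → α) (ι → α) R) (v : (κ → α) → R) :
    localOp g (localOp f Z) *ᵥ v = localOp (g ∘ f) Z *ᵥ v := by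
  classical
  have := Fintype.ofInjective g hg
  have := Fintype.ofInjective f hf
  funext s
  rw [localOp_mulVec_apply hg, localOp_mulVec_apply (hg.comp hf)]
  refine (localOp_mulVec_apply hf Z (fun t => v (Function.extend g t s)) (s ∘ g)).trans ?_
  simp only [hf.extend_comp hg, Function.comp_assoc]

theorem localOp_mulVec_comm {f : ι → κ} {g : μ → κ} (hf : f.Injective) (hg : g.Injective)
    (hfg : ∀ a b, f a ≠ g b) (X : Matrix (ι → α) (ι → α) R) (Y : Matrix (μ → α) (μ → α) R)
    (v : (κ → α) → R) :
    localOp f X *ᵥ (localOp g Y *ᵥ v) = localOp g Y *ᵥ (localOp f X *ᵥ v) := by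
  classical
  have := Fintype.ofInjective f hf
  have := Fintype.ofInjective g hg
  funext s
  simp only [localOp_mulVec_apply hf, localOp_mulVec_apply hg, Finset.mul_sum,
    extend_comp_of_disjoint hfg, extend_comp_of_disjoint fun b a => (hfg a b).symm,
    extend_extend_comm hf hg hfg]
  rw [Finset.sum_comm]
  simp only [mul_left_comm]

end LocalOperators

theorem blockOp_eq_localOp {d m : ℕ} (N : ℕ)
    (h : Matrix (Fin (m + 1) → Fin d) (Fin (m + 1) → Fin d) ℂ) (i : Fin N) :
    blockOp N h i = localOp (fun a : Fin (m + 1) => siteAdd i a) h := by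
  ext s t
  simp only [blockOp, localOp, Matrix.of_apply]
  congr

theorem siteOp_eq_localOp {p : ℕ} (N : ℕ) (q : Matrix (Fin p) (Fin p) ℂ) (j : Fin N) :
    siteOp N q j = localOp (fun _ : Fin 1 => j) (q.submatrix (· 0) (· 0)) := by
  ext s t
  simp only [siteOp, localOp, forall_const, Matrix.of_apply]
  congr

section Words

/-- The ordered product of the matrices of a tensor `A` along an open chain. -/
def word {α M : Type*} [Monoid M] (A : α → M) (u : List α) : M :=
  (u.map A).prod

theorem word_append {α M : Type*} [Monoid M] (A : α → M) (u v : List α) :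
    word A (u ++ v) = word A u * word A v := by
  rw [word, List.map_append, List.prod_append, word, word]

theorem word_nil {α M : Type*} [Monoid M] (A : α → M) : word A [] = 1 := rfl

variable {χ d : ℕ} (A : Fin d → Matrix (Fin χ) (Fin χ) ℂ)

theorem trace_word_rotate (u : List (Fin d)) (n : ℕ) :
    (word A (u.rotate n)).trace = (word A u).trace := by
  rw [List.rotate_eq_drop_append_take_mod, word_append, Matrix.trace_mul_comm, ← word_append,
    List.take_append_drop]

/-- The transfer matrix of the open chain with `n` sites, for blocks `F` (bra) and `G` (ket) of
bond matrices depending on the configuration of these sites. -/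
def mixedTransfer (n : ℕ) (F G : List (Fin d) → Matrix (Fin χ) (Fin χ) ℂ) :
    Matrix (Fin χ × Fin χ) (Fin χ × Fin χ) ℂ :=
  ∑ u : Fin n → Fin d, (F (List.ofFn u)).map (starRingEnd ℂ) ⊗ₖ G (List.ofFn u)

theorem trace_mixedTransfer (n : ℕ) (F G : List (Fin d) → Matrix (Fin χ) (Fin χ) ℂ) :
    (mixedTransfer n F G).trace =
      star (fun u : Fin n → Fin d => (F (List.ofFn u)).trace) ⬝ᵥ
        fun u => (G (List.ofFn u)).trace := by
  rw [mixedTransfer, Matrix.trace_sum, dotProduct]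
  refine Finset.sum_congr rfl fun u _ => ?_
  rw [Matrix.trace_kronecker]
  congr 1
  exact (AddMonoidHom.map_trace (starRingEnd ℂ) _).symm

theorem mixedTransfer_congr {n : ℕ} {F F' G G' : List (Fin d) → Matrix (Fin χ) (Fin χ) ℂ}
    (hF : ∀ u, u.length = n → F u = F' u) (hG : ∀ u, u.length = n → G u = G' u) :
    mixedTransfer n F G = mixedTransfer n F' G' :=
  Finset.sum_congr rfl fun u _ => by rw [hF _ List.length_ofFn, hG _ List.length_ofFn]

theorem mixedTransfer_add {n k : ℕ} {F G F₁ G₁ F₂ G₂ : List (Fin d) → Matrix (Fin χ) (Fin χ) ℂ}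
    (hF : ∀ u v, u.length = n → v.length = k → F (u ++ v) = F₁ u * F₂ v)
    (hG : ∀ u v, u.length = n → v.length = k → G (u ++ v) = G₁ u * G₂ v) :
    mixedTransfer (n + k) F G = mixedTransfer n F₁ G₁ * mixedTransfer k F₂ G₂ := by
  rw [mixedTransfer, ← (Fin.appendEquiv n k).sum_comp, Fintype.sum_prod_type, mixedTransfer,
    mixedTransfer, Finset.sum_mul_sum]
  refine Finset.sum_congr rfl fun u _ => Finset.sum_congr rfl fun v _ => ?_
  rw [← Matrix.mul_kronecker_mul, ← Matrix.map_mul,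
    ← hF _ _ List.length_ofFn List.length_ofFn, ← hG _ _ List.length_ofFn List.length_ofFn,
    ← List.ofFn_fin_append]
  rfl

theorem mixedTransfer_one_word (X Y : Fin d → Matrix (Fin χ) (Fin χ) ℂ) :
    mixedTransfer 1 (word X) (word Y) = transfer X Y := by
  rw [mixedTransfer, transfer, ← (Equiv.funUnique (Fin 1) (Fin d)).symm.sum_comp]
  simp [word]

theorem mixedTransfer_word (n : ℕ) :
    mixedTransfer n (word A) (word A) = transfer A A ^ n := by
  induction n with
  | zero => simp [mixedTransfer, word]
  | succ n ih =>
    rw [mixedTransfer_add (fun u v _ _ => word_append A u v) fun u v _ _ => word_append A u v,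
      ih, mixedTransfer_one_word, pow_succ]

/-- The product of the bond matrices of an open chain in which the block `Z` replaces the matrices
of the `l` sites to the right of the first `r` sites. -/
def insertWord (r l : ℕ) (Z : List (Fin d) → Matrix (Fin χ) (Fin χ) ℂ) (u : List (Fin d)) :
    Matrix (Fin χ) (Fin χ) ℂ :=
  word A (u.take r) * Z ((u.drop r).take l) * word A (u.drop (r + l))

variable (Z : List (Fin d) → Matrix (Fin χ) (Fin χ) ℂ)

theorem insertWord_append_word {r l : ℕ} {u : List (Fin d)} (h : r + l ≤ u.length)
    (v : List (Fin d)) : insertWord A r l Z (u ++ v) = insertWord A r l Z u * word A v := by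
  have hl : l ≤ (u.drop r).length := by rw [List.length_drop]; omega
  rw [insertWord, insertWord, List.take_append_of_le_length (by omega),
    List.drop_append_of_le_length (by omega), List.take_append_of_le_length hl,
    List.drop_append_of_le_length h, word_append, mul_assoc _ _ (word A v)]

theorem insertWord_word_append {r : ℕ} (l : ℕ) {u : List (Fin d)} (h : u.length = r)
    (v : List (Fin d)) : insertWord A r l Z (u ++ v) = word A u * insertWord A 0 l Z v := by
  subst h
  rw [insertWord, insertWord, List.take_left, List.drop_left, List.drop_length_add_append,
    List.take_zero, List.drop_zero, word_nil, one_mul, zero_add, mul_assoc]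

theorem insertWord_of_length {l : ℕ} {u : List (Fin d)} (h : u.length = l) :
    insertWord A 0 l Z u = Z u := by
  subst h
  simp [insertWord, word_nil]

end Words

section Insertions

variable {χ d : ℕ}

/-- The matrix-product state with tensor `A` on the periodic chain with `N` sites. -/
def mpsVec (N : ℕ) (A : Fin d → Matrix (Fin χ) (Fin χ) ℂ) : (Fin N → Fin d) → ℂ :=
  fun s => (word A (List.ofFn s)).trace

/-- The matrix-product state with tensor `A` in which the block `Z` of bond matrices replaces the
matrices of the `l` sites to the right of `i`, site `i` included. The chain is read starting at
`i`, so that the block may wrap around. -/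
def insertVec (N l : ℕ) (A : Fin d → Matrix (Fin χ) (Fin χ) ℂ)
    (Z : List (Fin d) → Matrix (Fin χ) (Fin χ) ℂ) (i : Fin N) : (Fin N → Fin d) → ℂ :=
  fun s => (insertWord A 0 l Z ((List.ofFn s).rotate i)).trace

/-- The matrix-product state with tensor `A` in which `B` replaces the tensor of site `j`. -/
def siteVec (N : ℕ) (A B : Fin d → Matrix (Fin χ) (Fin χ) ℂ) (j : Fin N) :
    (Fin N → Fin d) → ℂ :=
  insertVec N 1 A (word B) j

variable (A : Fin d → Matrix (Fin χ) (Fin χ) ℂ) (X Y Z : List (Fin d) → Matrix (Fin χ) (Fin χ) ℂ)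

theorem insertVec_apply {N l : ℕ} {i : Fin N} (h : i + l ≤ N) (s : Fin N → Fin d) :
    insertVec N l A Z i s = (insertWord A i l Z (List.ofFn s)).trace := by
  obtain ⟨u, v, huv, hu⟩ : ∃ u v, u ++ v = List.ofFn s ∧ u.length = (i : ℕ) :=
    ⟨_, _, List.take_append_drop i _, by simp⟩
  have hv : 0 + l ≤ v.length := by
    have := congrArg List.length huv
    simp only [List.length_append, List.length_ofFn] at this
    omega
  rw [insertVec, ← huv, insertWord_word_append A Z l hu, ← hu, List.rotate_append_length_eq,
    insertWord_append_word A Z hv, Matrix.trace_mul_comm]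

theorem insertVec_eq_insertVec_insertWord {N l n : ℕ} (hln : l ≤ n) (hn : n ≤ N) (i : Fin N) :
    insertVec N l A Z i = insertVec N n A (insertWord A 0 l Z) i := by
  funext s
  obtain ⟨u, v, huv, hu⟩ : ∃ u v, u ++ v = (List.ofFn s).rotate i ∧ u.length = n :=
    ⟨_, _, List.take_append_drop n _, by simpa using hn⟩
  rw [insertVec, insertVec, ← huv, insertWord_append_word A Z (by omega),
    insertWord_append_word A _ (by omega), insertWord_of_length A _ hu]

theorem dotProduct_insertVec {N l : ℕ} {i j : Fin N} (hi : i + l ≤ N) (hj : j + l ≤ N) :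
    star (insertVec N l A X i) ⬝ᵥ insertVec N l A Y j =
      (mixedTransfer N (insertWord A i l X) (insertWord A j l Y)).trace := by
  rw [trace_mixedTransfer]
  congr 1
  · simp only [← insertVec_apply A X hi]
  · simp only [← insertVec_apply A Y hj]

theorem mixedTransfer_insertWord_add {i j l n : ℕ} (hi : i + l ≤ n) (hj : j + l ≤ n) (b : ℕ) :
    mixedTransfer (n + b) (insertWord A i l X) (insertWord A j l Y) =
      mixedTransfer n (insertWord A i l X) (insertWord A j l Y) * transfer A A ^ b := by
  rw [← mixedTransfer_word]
  exact mixedTransfer_add (fun u v hu _ => insertWord_append_word A X (hu ▸ hi) v)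
    fun u v hu _ => insertWord_append_word A Y (hu ▸ hj) v

theorem mixedTransfer_insertWord_zero (l : ℕ) :
    mixedTransfer l (insertWord A 0 l X) (insertWord A 0 l Y) = mixedTransfer l X Y :=
  mixedTransfer_congr (fun _ => insertWord_of_length A X) fun _ => insertWord_of_length A Y

theorem mixedTransfer_insertWord_right (l a : ℕ) :
    mixedTransfer (l + a + l) (insertWord A 0 l X) (insertWord A (l + a) l Y) =
      mixedTransfer l X (word A) * transfer A A ^ a * mixedTransfer l (word A) Y := by
  rw [mixedTransfer_add (F₁ := insertWord A 0 l X) (F₂ := word A) (G₁ := word A) (G₂ := Y),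
    mixedTransfer_add (F₁ := X) (F₂ := word A) (G₁ := word A) (G₂ := word A), mixedTransfer_word]
  · intro u v hu _
    rw [insertWord_append_word A X (by omega), insertWord_of_length A X hu]
  · exact fun u v _ _ => word_append A u v
  · exact fun u v hu _ => insertWord_append_word A X (by omega) v
  · intro u v hu hv
    rw [insertWord_word_append A Y l hu, insertWord_of_length A Y hv]

theorem mixedTransfer_insertWord_left (l a : ℕ) :
    mixedTransfer (l + a + l) (insertWord A (l + a) l X) (insertWord A 0 l Y) =
      mixedTransfer l (word A) Y * transfer A A ^ a * mixedTransfer l X (word A) := by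
  rw [mixedTransfer_add (F₁ := word A) (F₂ := X) (G₁ := insertWord A 0 l Y) (G₂ := word A),
    mixedTransfer_add (F₁ := word A) (F₂ := word A) (G₁ := Y) (G₂ := word A), mixedTransfer_word]
  · exact fun u v _ _ => word_append A u v
  · intro u v hu _
    rw [insertWord_append_word A Y (by omega), insertWord_of_length A Y hu]
  · intro u v hu hv
    rw [insertWord_word_append A X l hu, insertWord_of_length A X hv]
  · exact fun u v hu _ => insertWord_append_word A Y (by omega) v

theorem insertVec_siteAdd {N : ℕ} (l : ℕ) (i : Fin N) (n : ℕ) (s : Fin N → Fin d) :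
    insertVec N l A Z (siteAdd i n) s = insertVec N l A Z i fun x => s (siteAdd x n) := by
  have hs : List.ofFn (fun x => s (siteAdd x n)) = (List.ofFn s).rotate n := by
    refine List.ext_getElem (by simp) fun x _ _ => ?_
    simp [List.getElem_rotate, siteAdd]
  rw [insertVec, insertVec, hs, List.rotate_rotate, add_comm n, ← List.rotate_mod _ (i + n),
    List.length_ofFn]
  rfl

end Insertions

namespace DominantResolution

variable {ι : Type*} [Fintype ι] [DecidableEq ι] {E : Matrix ι ι ℂ} (R : DominantResolution E)

/-- The matrix of all contractions `(l n| T |r n')`, that is, `T` written in the eigenbasis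
of `E`. -/
def contractMatrix (T : Matrix ι ι ℂ) : Matrix ι ι ℂ :=
  Matrix.of fun n n' => R.contract n T n'

theorem contractMatrix_eq (T : Matrix ι ι ℂ) :
    R.contractMatrix T = Matrix.of R.left * (T * (Matrix.of R.right)ᵀ) := rfl

theorem left_mul_right : Matrix.of R.left * (Matrix.of R.right)ᵀ = 1 := by
  ext n n'
  rw [Matrix.one_apply]
  exact R.biorthonormal n n'

theorem right_mul_left : (Matrix.of R.right)ᵀ * Matrix.of R.left = 1 :=
  mul_eq_one_comm.1 R.left_mul_right

theorem contractMatrix_mul (S T : Matrix ι ι ℂ) :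
    R.contractMatrix (S * T) = R.contractMatrix S * R.contractMatrix T := by
  simp only [contractMatrix_eq, mul_assoc]
  rw [← mul_assoc _ (Matrix.of R.left), R.right_mul_left, one_mul]

theorem trace_contractMatrix (T : Matrix ι ι ℂ) : (R.contractMatrix T).trace = T.trace := by
  rw [contractMatrix_eq, Matrix.trace_mul_comm, mul_assoc, R.right_mul_left, mul_one]

theorem mulVec_right (n : ι) : E *ᵥ R.right n = R.ev n • R.right n := by
  have h := congrArg (· *ᵥ R.right n) R.resolution
  simpa [Matrix.sum_mulVec, Matrix.smul_mulVec, Matrix.vecMulVec_mulVec, R.biorthonormal] using h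

theorem contractMatrix_self : R.contractMatrix E = Matrix.diagonal R.ev := by
  ext n n'
  rw [contractMatrix, Matrix.of_apply, contract, mulVec_right, dotProduct_smul, R.biorthonormal,
    Matrix.diagonal_apply]
  split_ifs with h
  · rw [h, smul_eq_mul, mul_one]
  · exact smul_zero _

theorem contractMatrix_pow (a : ℕ) : R.contractMatrix (E ^ a) = Matrix.diagonal (R.ev ^ a) := by
  induction a with
  | zero =>
    rw [pow_zero, contractMatrix_eq, one_mul, R.left_mul_right, pow_zero]
    exact Matrix.diagonal_one.symm
  | succ a ih =>
    rw [pow_succ, contractMatrix_mul, ih, contractMatrix_self, Matrix.diagonal_mul_diagonal]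
    rfl

theorem contractMatrix_mul_pow_apply (S : Matrix ι ι ℂ) (a : ℕ) (n n' : ι) :
    R.contractMatrix (S * E ^ a) n n' = R.contract n S n' * R.ev n' ^ a := by
  rw [contractMatrix_mul, contractMatrix_pow, Matrix.mul_diagonal]
  rfl

theorem contract_mul_pow_mul (S T : Matrix ι ι ℂ) (a : ℕ) (n n' : ι) :
    R.contract n (S * E ^ a * T) n' =
      ∑ k, R.contract n S k * R.ev k ^ a * R.contract k T n' := by
  change R.contractMatrix _ n n' = _
  rw [contractMatrix_mul, Matrix.mul_apply]
  simp only [contractMatrix_mul_pow_apply]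
  rfl

theorem trace_mul_pow (S : Matrix ι ι ℂ) (a : ℕ) :
    (S * E ^ a).trace = ∑ n, R.contract n S n * R.ev n ^ a := by
  rw [← R.trace_contractMatrix, Matrix.trace]
  simp only [Matrix.diag_apply, contractMatrix_mul_pow_apply]

/-- The decay rate of correlations, the modulus of the subdominant eigenvalue of `E`. -/
def decayRate : ℝ :=
  ‖Function.update R.ev R.top 0‖

theorem decayRate_nonneg : 0 ≤ R.decayRate :=
  norm_nonneg _

theorem decayRate_lt_one : R.decayRate < 1 := by
  rw [decayRate, pi_norm_lt_iff one_pos]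
  intro n
  by_cases hn : n = R.top
  · simp [hn]
  · simpa [hn] using R.norm_ev_lt_one n hn

theorem norm_ev_le_decayRate {n : ι} (hn : n ≠ R.top) : ‖R.ev n‖ ≤ R.decayRate := by
  simpa [hn, decayRate] using norm_le_pi_norm (Function.update R.ev R.top 0) n

theorem norm_ev_pow_le_one (n : ι) (a : ℕ) : ‖R.ev n ^ a‖ ≤ 1 := by
  rw [norm_pow]
  refine pow_le_one₀ (norm_nonneg _) ?_
  by_cases hn : n = R.top
  · rw [hn, R.ev_top, norm_one]
  · exact (R.norm_ev_lt_one n hn).le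

theorem norm_ev_pow_le {n : ι} (hn : n ≠ R.top) (a : ℕ) : ‖R.ev n ^ a‖ ≤ R.decayRate ^ a := by
  rw [norm_pow]
  exact pow_le_pow_left₀ (norm_nonneg _) (R.norm_ev_le_decayRate hn) a

theorem tendsto_ev_pow (n : ι) :
    Tendsto (fun a : ℕ => R.ev n ^ a) atTop (𝓝 (if n = R.top then 1 else 0)) := by
  split_ifs with hn
  · simp only [hn, R.ev_top, one_pow, tendsto_const_nhds]
  · exact tendsto_pow_atTop_nhds_zero_of_norm_lt_one (R.norm_ev_lt_one n hn)

theorem tendsto_trace_mul_pow (S : Matrix ι ι ℂ) :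
    Tendsto (fun a : ℕ => (S * E ^ a).trace) atTop (𝓝 (R.contract R.top S R.top)) := by
  simp only [R.trace_mul_pow]
  simpa using tendsto_finsetSum Finset.univ fun n _ =>
    (R.tendsto_ev_pow n).const_mul (R.contract n S n)

theorem norm_ev_pow_mul_ev_pow_sub_le (n n' : ι) (a b : ℕ) :
    ‖R.ev n ^ a * R.ev n' ^ b - if n = R.top ∧ n' = R.top then 1 else 0‖ ≤
      R.decayRate ^ a + R.decayRate ^ b := by
  have hpow : ∀ c : ℕ, 0 ≤ R.decayRate ^ c := fun c => pow_nonneg R.decayRate_nonneg c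
  by_cases hn : n = R.top
  · by_cases hn' : n' = R.top
    · simpa [hn, hn', R.ev_top] using add_nonneg (hpow a) (hpow b)
    · rw [if_neg fun h => hn' h.2, sub_zero, hn, R.ev_top, one_pow, one_mul]
      exact (R.norm_ev_pow_le hn' b).trans (le_add_of_nonneg_left (hpow a))
  · rw [if_neg fun h => hn h.1, sub_zero, norm_mul]
    calc _ ≤ R.decayRate ^ a * 1 := mul_le_mul (R.norm_ev_pow_le hn a)
          (R.norm_ev_pow_le_one n' b) (norm_nonneg _) (hpow a)
      _ ≤ _ := by rw [mul_one]; exact le_add_of_nonneg_right (hpow b)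

theorem exists_norm_trace_sub_le (S T : Matrix ι ι ℂ) : ∃ C : ℝ, 0 ≤ C ∧ ∀ a b : ℕ,
    ‖(S * E ^ a * T * E ^ b).trace - R.contract R.top S R.top * R.contract R.top T R.top‖ ≤
      C * (R.decayRate ^ a + R.decayRate ^ b) := by
  refine ⟨∑ n, ∑ k, ‖R.contract n S k * R.contract k T n‖, by positivity, fun a b => ?_⟩
  have htop : R.contract R.top S R.top * R.contract R.top T R.top =
      ∑ n, ∑ k, R.contract n S k * R.contract k T n *
        if k = R.top ∧ n = R.top then 1 else 0 := by
    simp [ite_and]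
  have hdiff : (S * E ^ a * T * E ^ b).trace -
      R.contract R.top S R.top * R.contract R.top T R.top =
        ∑ n, ∑ k, R.contract n S k * R.contract k T n *
          (R.ev k ^ a * R.ev n ^ b - if k = R.top ∧ n = R.top then 1 else 0) := by
    simp only [htop, R.trace_mul_pow, contract_mul_pow_mul, mul_sub, Finset.sum_sub_distrib,
      Finset.sum_mul]
    congr 1
    exact Finset.sum_congr rfl fun n _ => Finset.sum_congr rfl fun k _ => by ring
  rw [hdiff, Finset.sum_mul]
  refine norm_sum_le_of_le _ fun n _ => ?_
  rw [Finset.sum_mul]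
  refine norm_sum_le_of_le _ fun k _ => ?_
  rw [norm_mul]
  gcongr
  exact R.norm_ev_pow_mul_ev_pow_sub_le k n a b

theorem contract_mul_pow_mul_sub (S T : Matrix ι ι ℂ) (a : ℕ) :
    R.contract R.top (S * E ^ a * T) R.top -
        R.contract R.top S R.top * R.contract R.top T R.top =
      ∑ n ∈ Finset.univ.erase R.top,
        R.ev n ^ a * (R.contract R.top S n * R.contract n T R.top) := by
  rw [contract_mul_pow_mul, ← Finset.add_sum_erase _ _ (Finset.mem_univ R.top), R.ev_top, one_pow,
    mul_one, add_sub_cancel_left]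
  exact Finset.sum_congr rfl fun n _ => by ring

theorem hasSum_contract_mul_pow_mul_sub (S T : Matrix ι ι ℂ) {w : ℂ} (hw : ‖w‖ = 1) :
    HasSum (fun a : ℕ => w ^ (a + 1) * (R.contract R.top (S * E ^ a * T) R.top -
        R.contract R.top S R.top * R.contract R.top T R.top))
      (∑ n ∈ Finset.univ.erase R.top,
        R.contract R.top S n * R.contract n T R.top / (w⁻¹ - R.ev n)) := by
  have hw0 : w ≠ 0 := norm_ne_zero_iff.1 (hw ▸ one_ne_zero)
  simp only [contract_mul_pow_mul_sub, Finset.mul_sum]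
  refine hasSum_sum fun n hn => ?_
  have hlt : ‖w * R.ev n‖ < 1 := by
    rw [norm_mul, hw, one_mul]
    exact R.norm_ev_lt_one n (Finset.ne_of_mem_erase hn)
  have hgeom := (hasSum_geometric_of_norm_lt_one hlt).mul_left
    (w * (R.contract R.top S n * R.contract n T R.top))
  have hinv : w⁻¹ - R.ev n = w⁻¹ * (1 - w * R.ev n) := by field_simp
  have hlim : R.contract R.top S n * R.contract n T R.top / (w⁻¹ - R.ev n) =
      w * (R.contract R.top S n * R.contract n T R.top) * (1 - w * R.ev n)⁻¹ := by
    rw [hinv, div_eq_mul_inv, mul_inv, inv_inv]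
    ring
  rw [hlim]
  exact hgeom.congr_fun fun a => by ring

end DominantResolution

section NormalizedStates

open scoped ComplexOrder

variable {ι : Type*} [Fintype ι]

/-- The Hilbert space norm of a state. -/
def vecNorm (v : ι → ℂ) : ℝ :=
  Real.sqrt (star v ⬝ᵥ v).re

/-- The state `v`, normalized. The zero vector is normalized to zero. -/
def normalize (v : ι → ℂ) : ι → ℂ :=
  (vecNorm v : ℂ)⁻¹ • v

/-- The state `(H - E) v`, which measures how far `v` is from being an eigenstate of `H` with energy
`E`. -/
def residual (H : Matrix ι ι ℂ) (E : ℝ) (v : ι → ℂ) : ι → ℂ :=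
  H *ᵥ v - (E : ℂ) • v

theorem coe_vecNorm_sq (v : ι → ℂ) : (vecNorm v : ℂ) ^ 2 = star v ⬝ᵥ v := by
  have hnonneg : 0 ≤ star v ⬝ᵥ v := dotProduct_star_self_nonneg v
  rw [vecNorm, ← Complex.ofReal_pow, Real.sq_sqrt (Complex.nonneg_iff.1 hnonneg).1]
  exact (Complex.eq_re_of_ofReal_le hnonneg).symm

theorem expectation_normalize (O : Matrix ι ι ℂ) (v : ι → ℂ) :
    expectation O (normalize v) = ((star v ⬝ᵥ O *ᵥ v) / (star v ⬝ᵥ v)).re := by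
  rw [expectation, normalize, Matrix.mulVec_smul, star_smul, smul_dotProduct, dotProduct_smul,
    Complex.star_def, map_inv₀, Complex.conj_ofReal, smul_smul, smul_eq_mul, ← mul_inv, ← sq,
    coe_vecNorm_sq, div_eq_inv_mul]

variable {H : Matrix ι ι ℂ} {v : ι → ℂ}

theorem expectation_normalize_sub (hv : star v ⬝ᵥ v ≠ 0) (E : ℝ) :
    expectation H (normalize v) - E =
      ((star v ⬝ᵥ residual H E v) / (star v ⬝ᵥ v)).re := by
  rw [expectation_normalize, residual, dotProduct_sub, dotProduct_smul, sub_div, Complex.sub_re,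
    smul_eq_mul, mul_div_cancel_right₀ _ hv, Complex.ofReal_re]

theorem dotProduct_mulVec_of_isHermitian (hH : H.IsHermitian) (u w : ι → ℂ) :
    star (H *ᵥ u) ⬝ᵥ w = star u ⬝ᵥ H *ᵥ w := by
  rw [Matrix.star_mulVec, hH.eq, Matrix.dotProduct_mulVec]

theorem dotProduct_residual_eq_zero (hH : H.IsHermitian) {E : ℝ} {u : ι → ℂ}
    (hu : H *ᵥ u = (E : ℂ) • u) (w : ι → ℂ) : star u ⬝ᵥ residual H E w = 0 := by
  rw [residual, dotProduct_sub, ← dotProduct_mulVec_of_isHermitian hH, hu, star_smul,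
    smul_dotProduct, dotProduct_smul, Complex.star_def, Complex.conj_ofReal, sub_self]

theorem energyVariance_normalize (hH : H.IsHermitian) (hv : star v ⬝ᵥ v ≠ 0) (E : ℝ) :
    energyVariance H (normalize v) =
      ((star (residual H E v) ⬝ᵥ residual H E v) / (star v ⬝ᵥ v)).re -
        (expectation H (normalize v) - E) ^ 2 := by
  have hexpand : star (residual H E v) ⬝ᵥ residual H E v =
      star v ⬝ᵥ (H * H) *ᵥ v - 2 * E * (star v ⬝ᵥ H *ᵥ v) + E ^ 2 * (star v ⬝ᵥ v) := by
    simp only [residual, star_sub, star_smul, sub_dotProduct, dotProduct_sub, smul_dotProduct,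
      dotProduct_smul, dotProduct_mulVec_of_isHermitian hH, Matrix.mulVec_mulVec,
      Complex.star_def, Complex.conj_ofReal, smul_eq_mul]
    ring
  have hdiv : (star (residual H E v) ⬝ᵥ residual H E v) / (star v ⬝ᵥ v) =
      (star v ⬝ᵥ (H * H) *ᵥ v) / (star v ⬝ᵥ v) -
        ((2 * E : ℝ) : ℂ) * ((star v ⬝ᵥ H *ᵥ v) / (star v ⬝ᵥ v)) + ((E ^ 2 : ℝ) : ℂ) := by
    rw [hexpand]
    push_cast
    field_simp
  rw [energyVariance, hdiv, Complex.add_re, Complex.sub_re, Complex.re_ofReal_mul,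
    Complex.ofReal_re, ← expectation_normalize, ← expectation_normalize]
  ring

end NormalizedStates

section ExtensiveLimits

variable {ι : ℕ → Type*} [∀ N, Fintype (ι N)] {H : ∀ N, Matrix (ι N) (ι N) ℂ}
  {v : ∀ N, ι N → ℂ} {E : ℕ → ℝ} {D F F' : ℂ}

theorem tendsto_vecNorm_div_sqrt (hv : Tendsto (fun N => (star (v N) ⬝ᵥ v N) / N) atTop (𝓝 D)) :
    Tendsto (fun N => vecNorm (v N) / Real.sqrt N) atTop (𝓝 (Real.sqrt D.re)) := by
  refine ((Real.continuous_sqrt.comp Complex.continuous_re).tendsto D |>.comp hv).congr fun N => ?_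
  rw [Function.comp_apply, Function.comp_apply, Complex.div_natCast_re, vecNorm,
    Real.sqrt_div' _ N.cast_nonneg]

theorem tendsto_div_dotProduct_self
    (hv : Tendsto (fun N => (star (v N) ⬝ᵥ v N) / N) atTop (𝓝 D)) (hD : D ≠ 0) {a : ℕ → ℂ}
    (ha : Tendsto (fun N => a N / N) atTop (𝓝 F)) :
    Tendsto (fun N => (a N / (star (v N) ⬝ᵥ v N)).re) atTop (𝓝 (F / D).re) := by
  refine ((Complex.continuous_re.tendsto _).comp (ha.div hv hD)).congr' ?_
  filter_upwards [eventually_ne_atTop 0] with N hN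
  exact congrArg Complex.re (div_div_div_cancel_right₀ (Nat.cast_ne_zero.2 hN) _ _)

theorem eventually_dotProduct_self_ne_zero
    (hv : Tendsto (fun N => (star (v N) ⬝ᵥ v N) / N) atTop (𝓝 D)) (hD : D ≠ 0) :
    ∀ᶠ N in atTop, star (v N) ⬝ᵥ v N ≠ 0 :=
  (hv.eventually_ne hD).mono fun _ hN h0 => hN (by rw [h0, zero_div])

theorem tendsto_expectation_normalize_sub
    (hv : Tendsto (fun N => (star (v N) ⬝ᵥ v N) / N) atTop (𝓝 D)) (hD : D ≠ 0)
    (hF : Tendsto (fun N => (star (v N) ⬝ᵥ residual (H N) (E N) (v N)) / N) atTop (𝓝 F)) :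
    Tendsto (fun N => expectation (H N) (normalize (v N)) - E N) atTop (𝓝 (F / D).re) := by
  refine (tendsto_div_dotProduct_self hv hD hF).congr' ?_
  filter_upwards [eventually_dotProduct_self_ne_zero hv hD] with N hN
  exact (expectation_normalize_sub hN (E N)).symm

theorem tendsto_energyVariance_normalize (hH : ∀ N, (H N).IsHermitian)
    (hv : Tendsto (fun N => (star (v N) ⬝ᵥ v N) / N) atTop (𝓝 D)) (hD : D ≠ 0)
    (hF : Tendsto (fun N => (star (v N) ⬝ᵥ residual (H N) (E N) (v N)) / N) atTop (𝓝 F))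
    (hF' : Tendsto (fun N => (star (residual (H N) (E N) (v N)) ⬝ᵥ
      residual (H N) (E N) (v N)) / N) atTop (𝓝 F')) :
    Tendsto (fun N => energyVariance (H N) (normalize (v N))) atTop
      (𝓝 ((F' / D).re - (F / D).re ^ 2)) := by
  refine ((tendsto_div_dotProduct_self hv hD hF').sub
    ((tendsto_expectation_normalize_sub hv hD hF).pow 2)).congr' ?_
  filter_upwards [eventually_dotProduct_self_ne_zero hv hD] with N hN
  exact (energyVariance_normalize (hH N) hN (E N)).symm

end ExtensiveLimits

section Ring

variable {N : ℕ}

theorem siteAdd_siteAdd (i : Fin N) (a b : ℕ) : siteAdd (siteAdd i a) b = siteAdd i (a + b) := by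
  ext
  simp [siteAdd, add_assoc]

theorem siteAdd_right_comm (i : Fin N) (a b : ℕ) :
    siteAdd (siteAdd i a) b = siteAdd (siteAdd i b) a := by
  rw [siteAdd_siteAdd, siteAdd_siteAdd, add_comm]

theorem siteAdd_eq_of_add_eq {i j : Fin N} {a : ℕ} (h : (i : ℕ) + a = j) : siteAdd i a = j :=
  Fin.ext ((congrArg (· % N) h).trans (Nat.mod_eq_of_lt j.isLt))

theorem window_injective {l : ℕ} (hl : l ≤ N) (i : Fin N) :
    Function.Injective fun a : Fin l => siteAdd i a := by
  intro a b hab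
  have hmod : a.val ≡ b.val [MOD N] := Nat.ModEq.add_left_cancel' i.val (congrArg Fin.val hab)
  exact Fin.ext (hmod.eq_of_lt_of_lt (a.isLt.trans_le hl) (b.isLt.trans_le hl))

theorem siteAdd_injective (n : ℕ) : Function.Injective fun i : Fin N => siteAdd i n := by
  intro i j hij
  have hmod : i.val ≡ j.val [MOD N] := Nat.ModEq.add_right_cancel' n (congrArg Fin.val hij)
  exact Fin.ext (hmod.eq_of_lt_of_lt i.isLt j.isLt)

theorem sum_siteAdd_window {β : Type*} [AddCommMonoid β] (f : Fin N → β) (i : Fin N) :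
    ∑ r : Fin N, f (siteAdd i r) = ∑ j, f j :=
  (Finite.injective_iff_bijective.1 (window_injective le_rfl i)).sum_comp f

theorem sum_siteAdd {β : Type*} [AddCommMonoid β] (f : Fin N → β) (n : ℕ) :
    ∑ i, f (siteAdd i n) = ∑ i, f i :=
  (Finite.injective_iff_bijective.1 (siteAdd_injective n)).sum_comp f

variable {α : Type*} {X Y : Fin N → (Fin N → α) → ℂ}

/-- A family of states labelled by the sites of a ring which are translates of one another. -/
def IsCovariant (V : Fin N → (Fin N → α) → ℂ) : Prop :=
  ∀ i n s, V (siteAdd i n) s = V i fun x => s (siteAdd x n)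

/-- The superposition of a family of states whose momentum `k` is given by `z = exp (i k)`. -/
def fourierVec (z : Circle) (V : Fin N → (Fin N → α) → ℂ) : (Fin N → α) → ℂ :=
  ∑ j, (z : ℂ) ^ j.val • V j

theorem fourierVec_one (V : Fin N → (Fin N → α) → ℂ) : fourierVec 1 V = ∑ j, V j := by
  simp only [fourierVec, Circle.coe_one, one_pow, one_smul]

variable [Fintype α]

/-- The overlap of the states of two families at distance `r`, averaged over the ring. -/
def corr (X Y : Fin N → (Fin N → α) → ℂ) (r : ℕ) : ℂ :=
  (∑ i, star (X i) ⬝ᵥ Y (siteAdd i r)) / N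

theorem IsCovariant.dotProduct_siteAdd (hX : IsCovariant X) (hY : IsCovariant Y) (i j : Fin N)
    (n : ℕ) : star (X (siteAdd i n)) ⬝ᵥ Y (siteAdd j n) = star (X i) ⬝ᵥ Y j := by
  let shift := Equiv.ofBijective _ (Finite.injective_iff_bijective.1 (siteAdd_injective (N := N) n))
  rw [dotProduct, dotProduct,
    ← (shift.symm.arrowCongr (Equiv.refl α)).sum_comp fun s => star (X i) s * Y j s]
  refine Finset.sum_congr rfl fun s _ => ?_
  rw [Pi.star_apply, Pi.star_apply, hX, hY]
  rfl

theorem IsCovariant.corr_eq (hX : IsCovariant X) (hY : IsCovariant Y) {i j : Fin N} {r : ℕ}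
    (h : siteAdd i r = j) : corr X Y r = star (X i) ⬝ᵥ Y j := by
  have hconst : ∀ n : Fin N, star (X (siteAdd i n)) ⬝ᵥ Y (siteAdd (siteAdd i n) r) =
      star (X i) ⬝ᵥ Y j := fun n => by
    rw [siteAdd_right_comm, h, hX.dotProduct_siteAdd hY]
  have hN : (N : ℂ) ≠ 0 := Nat.cast_ne_zero.2 i.pos.ne'
  rw [corr, ← sum_siteAdd_window _ i, Finset.sum_congr rfl fun n _ => hconst n, Finset.sum_const,
    Finset.card_univ, Fintype.card_fin, nsmul_eq_mul, mul_div_cancel_left₀ _ hN]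

theorem corr_comp_siteAdd (X Y : Fin N → (Fin N → α) → ℂ) (n r : ℕ) :
    corr (fun j => X (siteAdd j n)) (fun j => Y (siteAdd j n)) r = corr X Y r := by
  rw [corr, corr, ← sum_siteAdd (fun i => star (X i) ⬝ᵥ Y (siteAdd i r)) n]
  simp only [siteAdd_right_comm _ r n]

theorem pow_siteAdd {z : Circle} (hz : z ^ N = 1) (i : Fin N) (r : ℕ) :
    z ^ (siteAdd i r).val = z ^ i.val * z ^ r := by
  rw [← pow_add, siteAdd]
  exact (pow_eq_pow_mod _ hz).symm

/-- The quantization `z ^ N = 1` of the momentum makes the sum over pairs of sites depend on the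
distance only. -/
theorem dotProduct_fourierVec (X Y : Fin N → (Fin N → α) → ℂ) {z : Circle} (hz : z ^ N = 1) :
    star (fourierVec z X) ⬝ᵥ fourierVec z Y =
      N * ∑ r ∈ Finset.range N, (z : ℂ) ^ r * corr X Y r := by
  rcases N.eq_zero_or_pos with rfl | hN
  · simp [fourierVec]
  have hphase : ∀ i : Fin N, ∀ r : ℕ,
      star ((z : ℂ) ^ i.val) * (z : ℂ) ^ (siteAdd i r).val = (z : ℂ) ^ r := fun i r => by
    have h := congrArg ((↑) : Circle → ℂ) (pow_siteAdd hz i r)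
    simp only [Circle.coe_mul, Circle.coe_pow] at h
    rw [h, ← mul_assoc, Complex.star_def, Complex.conj_mul', norm_pow, Circle.norm_coe]
    simp
  have hsum : ∀ i : Fin N, star ((z : ℂ) ^ i.val • X i) ⬝ᵥ fourierVec z Y =
      ∑ r : Fin N, (z : ℂ) ^ r.val * (star (X i) ⬝ᵥ Y (siteAdd i r)) := fun i => by
    rw [fourierVec, ← sum_siteAdd_window _ i, dotProduct_sum]
    refine Finset.sum_congr rfl fun r _ => ?_
    rw [star_smul, smul_dotProduct, dotProduct_smul, smul_smul, hphase, smul_eq_mul]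
  conv_lhs => rw [fourierVec, star_sum, sum_dotProduct, Finset.sum_congr rfl fun i _ => hsum i]
  rw [Finset.sum_comm, Finset.sum_range, Finset.mul_sum]
  refine Finset.sum_congr rfl fun r _ => ?_
  have hN0 : (N : ℂ) ≠ 0 := Nat.cast_ne_zero.2 hN.ne'
  rw [← Finset.mul_sum, corr]
  field_simp

theorem dotProduct_fourierVec_comp_siteAdd (X Y : Fin N → (Fin N → α) → ℂ) {z : Circle}
    (hz : z ^ N = 1) (n : ℕ) :
    star (fourierVec z fun j => X (siteAdd j n)) ⬝ᵥ (fourierVec z fun j => Y (siteAdd j n)) =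
      star (fourierVec z X) ⬝ᵥ fourierVec z Y := by
  simp only [dotProduct_fourierVec _ _ hz, corr_comp_siteAdd]

end Ring

section Momenta

theorem circleExp_pow_eq_one {N : ℕ} (hN : N ≠ 0) {k : ℝ} (hk : k ∈ momenta N) :
    Circle.exp k ^ N = 1 := by
  obtain ⟨n, -, rfl⟩ := hk
  rw [← Circle.exp_natCast_mul, mul_div_cancel₀ _ (Nat.cast_ne_zero.2 hN),
    Circle.exp_two_pi_mul_int]

theorem circleExp_ne_one {N : ℕ} (hN : N ≠ 0) {k : ℝ} (hk : k ∈ momenta N) :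
    Circle.exp k ≠ 1 := by
  obtain ⟨n, hn, rfl⟩ := hk
  rw [Ne, Circle.exp_eq_one]
  rintro ⟨j, hj⟩
  refine hn ⟨j, ?_⟩
  have hN' : (N : ℝ) ≠ 0 := Nat.cast_ne_zero.2 hN
  have hπ := Real.pi_ne_zero
  field_simp at hj
  exact_mod_cast hj

theorem eventually_circleExp_pow_eq_one {κ : ℕ → ℝ} (hκ : ∀ᶠ N in atTop, κ N ∈ momenta N) :
    ∀ᶠ N in atTop, Circle.exp (κ N) ^ N = 1 := by
  filter_upwards [hκ, eventually_ne_atTop 0] with N hN hN0 using circleExp_pow_eq_one hN0 hN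

theorem eventually_circleExp_ne_one {κ : ℕ → ℝ} (hκ : ∀ᶠ N in atTop, κ N ∈ momenta N) :
    ∀ᶠ N in atTop, Circle.exp (κ N) ≠ 1 := by
  filter_upwards [hκ, eventually_ne_atTop 0] with N hN hN0 using circleExp_ne_one hN0 hN

theorem exists_not_dvd_abs_sub_le_one {N : ℤ} (hN : 2 ≤ N) (x : ℝ) :
    ∃ n : ℤ, ¬ N ∣ n ∧ |(n : ℝ) - x| ≤ 1 := by
  by_cases hdvd : N ∣ ⌊x⌋
  · refine ⟨⌊x⌋ + 1, fun h => ?_, ?_⟩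
    · have := Int.le_of_dvd one_pos ((Int.dvd_add_right hdvd).1 h)
      lia
    · push_cast
      exact abs_le.2 ⟨by linarith [Int.lt_floor_add_one x], by linarith [Int.floor_le x]⟩
  · exact ⟨⌊x⌋, hdvd,
      abs_le.2 ⟨by linarith [Int.lt_floor_add_one x], by linarith [Int.floor_le x]⟩⟩

theorem exists_mem_momenta_abs_sub_le {N : ℕ} (hN : 2 ≤ N) (k : ℝ) :
    ∃ κ ∈ momenta N, |κ - k| ≤ 2 * Real.pi / N := by
  obtain ⟨n, hn, hnk⟩ := exists_not_dvd_abs_sub_le_one (N := N) (by lia) (k * N / (2 * Real.pi))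
  refine ⟨2 * Real.pi * n / N, ⟨n, hn, rfl⟩, ?_⟩
  have : (0 : ℝ) < N := by positivity
  have hscale : 2 * Real.pi * n / N - k = 2 * Real.pi / N * (n - k * N / (2 * Real.pi)) := by
    field_simp
  rw [hscale, abs_mul, abs_of_pos (by positivity)]
  exact mul_le_of_le_one_right (by positivity) hnk

theorem exists_momenta_tendsto (k : ℝ) :
    ∃ κ : ℕ → ℝ, (∀ᶠ N in atTop, κ N ∈ momenta N) ∧ Tendsto κ atTop (𝓝 k) := by
  choose! κ hmem hle using fun N (hN : 2 ≤ N) => exists_mem_momenta_abs_sub_le hN k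
  have hlarge : ∀ᶠ N : ℕ in atTop, 2 ≤ N := eventually_ge_atTop 2
  exact ⟨κ, hlarge.mono hmem, tendsto_iff_norm_sub_tendsto_zero.2 <|
    squeeze_zero' (Eventually.of_forall fun _ => norm_nonneg _) (hlarge.mono hle)
      (tendsto_const_div_atTop_nhds_zero_nat _)⟩

end Momenta

section Clustering

theorem tendsto_sum_range_of_dominated {f : ℕ → ℕ → ℂ} {F : ℕ → ℂ} {b : ℕ → ℝ} {n : ℕ → ℕ} {l : ℕ}
    (hb : Summable b) (hn : Tendsto n atTop atTop)
    (hf : ∀ r, Tendsto (fun N => f N r) atTop (𝓝 (F r)))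
    (hfb : ∀ N r, l ≤ r → r < n N → ‖f N r‖ ≤ b r) :
    Tendsto (fun N => ∑ r ∈ Finset.range (n N), f N r) atTop (𝓝 (∑' r, F r)) := by
  have hbound : Summable fun r => if r < l then ‖F r‖ + 1 else |b r| :=
    hb.abs.congr_cofinite <| (Set.finite_lt_nat l).subset fun r hr => by
      by_contra h
      exact hr (if_neg h).symm
  have hsmall : ∀ᶠ N in atTop, ∀ r ∈ Finset.range l, ‖f N r‖ < ‖F r‖ + 1 :=
    (eventually_all_finset _).2 fun r _ => (hf r).norm.eventually_lt_const (lt_add_one _)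
  have htsum : ∀ N, ∑' r, (if r < n N then f N r else 0) = ∑ r ∈ Finset.range (n N), f N r :=
    fun N => by
      rw [tsum_eq_sum fun r hr => if_neg (mt Finset.mem_range.2 hr)]
      exact Finset.sum_congr rfl fun r hr => if_pos (Finset.mem_range.1 hr)
  refine (tendsto_tsum_of_dominated_convergence hbound (fun r => ?_) ?_).congr htsum
  · refine (hf r).congr' ?_
    filter_upwards [hn.eventually_gt_atTop r] with N hr
    rw [if_pos hr]
  · filter_upwards [hsmall] with N hN r
    split_ifs with hrn hrl hrl
    · exact (hN r (Finset.mem_range.2 hrl)).le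
    · exact (hfb N r (not_lt.1 hrl) hrn).trans (le_abs_self _)
    · rw [norm_zero]; positivity
    · rw [norm_zero]; positivity

/-- The connected two-point functions `f N r` at distance `r` on the rings with `N` sites, which
have limits at fixed distances `r` to the right and `r + 1` to the left, and which decay summably
and uniformly in `N`. -/
structure Clusters (f : ℕ → ℕ → ℂ) (right left : ℕ → ℂ) : Prop where
  tendsto_right : ∀ r, Tendsto (fun N => f N r) atTop (𝓝 (right r))
  tendsto_left : ∀ r, Tendsto (fun N => f N (N - (r + 1))) atTop (𝓝 (left r))
  exists_bound : ∃ b : ℕ → ℝ, Summable b ∧ ∃ l, ∀ N r, l ≤ r →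
    2 * r + 1 ≤ N → ‖f N r‖ ≤ b r ∧ ‖f N (N - (r + 1))‖ ≤ b r

/-- The Fourier sum of a two-point function on the infinite chain, at the momentum `k` given by
`z = exp (i k)`. -/
def lineSum (right left : ℕ → ℂ) (z : Circle) : ℂ :=
  (∑' r : ℕ, (z : ℂ) ^ r * right r) + ∑' r : ℕ, ((z⁻¹ : Circle) : ℂ) ^ (r + 1) * left r

theorem norm_circle_pow_mul (z : Circle) (n : ℕ) (w : ℂ) : ‖(z : ℂ) ^ n * w‖ = ‖w‖ := by
  rw [norm_mul, norm_pow, Circle.norm_coe, one_pow, one_mul]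

namespace Clusters

variable {f : ℕ → ℕ → ℂ} {right left : ℕ → ℂ}

theorem summable_norm_right (h : Clusters f right left) : Summable fun r => ‖right r‖ := by
  obtain ⟨b, hb, l, hle⟩ := h.exists_bound
  refine .of_norm_bounded_eventually_nat hb ?_
  filter_upwards [eventually_ge_atTop l] with r hr
  rw [norm_norm]
  refine le_of_tendsto (h.tendsto_right r).norm ?_
  filter_upwards [eventually_ge_atTop (2 * r + 1)] with N hN
  exact (hle N r hr hN).1

theorem summable_norm_left (h : Clusters f right left) : Summable fun r => ‖left r‖ := by
  obtain ⟨b, hb, l, hle⟩ := h.exists_bound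
  refine .of_norm_bounded_eventually_nat hb ?_
  filter_upwards [eventually_ge_atTop l] with r hr
  rw [norm_norm]
  refine le_of_tendsto (h.tendsto_left r).norm ?_
  filter_upwards [eventually_ge_atTop (2 * r + 1)] with N hN
  exact (hle N r hr hN).2

theorem continuous_lineSum (h : Clusters f right left) : Continuous (lineSum right left) :=
  (continuous_tsum (fun r => by fun_prop) h.summable_norm_right fun r z =>
      (norm_circle_pow_mul z r _).le).add
    (continuous_tsum (fun r => by fun_prop) h.summable_norm_left fun r z =>
      (norm_circle_pow_mul z⁻¹ (r + 1) _).le)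

theorem tendsto_sum (h : Clusters f right left) {ζ : ℕ → Circle} {z : Circle}
    (hζ : ∀ᶠ N in atTop, ζ N ^ N = 1) (hz : Tendsto ζ atTop (𝓝 z)) :
    Tendsto (fun N => ∑ r ∈ Finset.range N, (ζ N : ℂ) ^ r * f N r) atTop
      (𝓝 (lineSum right left z)) := by
  obtain ⟨b, hb, l, hle⟩ := h.exists_bound
  have hcoe : Continuous ((↑) : Circle → ℂ) := by fun_prop
  have hζz : Tendsto (fun N => (ζ N : ℂ)) atTop (𝓝 z) := (hcoe.tendsto z).comp hz
  have hζz' : Tendsto (fun N => ((ζ N)⁻¹ : Circle) : ℕ → ℂ) atTop (𝓝 (z⁻¹ : Circle)) :=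
    (hcoe.tendsto (z⁻¹ : Circle)).comp hz.inv
  have hright := tendsto_sum_range_of_dominated (n := fun N => (N + 1) / 2) hb
    (tendsto_atTop.2 fun r => (eventually_ge_atTop (2 * r)).mono fun N hN => by lia)
    (fun r => (hζz.pow r).mul (h.tendsto_right r)) fun N r hlr hr =>
      (norm_circle_pow_mul (ζ N) r _).trans_le (hle N r hlr (by lia)).1
  have hleft := tendsto_sum_range_of_dominated (n := fun N => N / 2) hb
    (tendsto_atTop.2 fun r => (eventually_ge_atTop (2 * r)).mono fun N hN => by lia)
    (fun r => (hζz'.pow (r + 1)).mul (h.tendsto_left r)) fun N r hlr hr =>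
      (norm_circle_pow_mul (ζ N)⁻¹ (r + 1) _).trans_le (hle N r hlr (by lia)).2
  refine (hright.add hleft).congr' ?_
  filter_upwards [hζ] with N hN
  have hreflect : ∀ r < N / 2, (((ζ N)⁻¹ : Circle) : ℂ) ^ (r + 1) = (ζ N : ℂ) ^ (N - (r + 1)) :=
    fun r hr => by
      rw [← Circle.coe_pow, ← Circle.coe_pow, inv_pow, inv_eq_of_mul_eq_one_left]
      rw [← pow_add, Nat.sub_add_cancel (by lia), hN]
  have hsplit : (N + 1) / 2 + N / 2 = N := by lia
  conv_rhs => rw [← hsplit, Finset.sum_range_add, ← Finset.sum_range_reflect _ (N / 2), hsplit]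
  congr 1
  refine Finset.sum_congr rfl fun r hr => ?_
  have hr' := Finset.mem_range.1 hr
  rw [hreflect r hr', show N - (r + 1) = (N + 1) / 2 + (N / 2 - 1 - r) by lia]

end Clusters

end Clustering

section StructureFactor

variable {χ d : ℕ} {A : Fin d → Matrix (Fin χ) (Fin χ) ℂ}
  (R : DominantResolution (transfer A A)) (l : ℕ)
  (X Y : List (Fin d) → Matrix (Fin χ) (Fin χ) ℂ)

theorem isCovariant_insertVec (N : ℕ) (A : Fin d → Matrix (Fin χ) (Fin χ) ℂ) :
    IsCovariant (insertVec N l A X) :=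
  insertVec_siteAdd A X l

theorem corr_insertVec_right {N r : ℕ} (hr : r < N) (hrl : r + l ≤ N) :
    corr (insertVec N l A X) (insertVec N l A Y) r =
      (mixedTransfer (r + l) (insertWord A 0 l X) (insertWord A r l Y) *
        transfer A A ^ (N - (r + l))).trace := by
  rw [(isCovariant_insertVec l X N A).corr_eq (isCovariant_insertVec l Y N A)
      (i := ⟨0, by lia⟩) (j := ⟨r, hr⟩) (siteAdd_eq_of_add_eq (zero_add r)),
    dotProduct_insertVec A X Y (by simp only; lia) hrl,
    ← mixedTransfer_insertWord_add A X Y (by lia) le_rfl, Nat.add_sub_cancel' hrl]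

theorem corr_insertVec_left {N r : ℕ} (hr : 0 < r) (hrN : r < N) (hrl : r + l ≤ N) :
    corr (insertVec N l A X) (insertVec N l A Y) (N - r) =
      (mixedTransfer (r + l) (insertWord A r l X) (insertWord A 0 l Y) *
        transfer A A ^ (N - (r + l))).trace := by
  have hshift : siteAdd (⟨r, hrN⟩ : Fin N) (N - r) = ⟨0, by lia⟩ :=
    Fin.ext (by simp only [siteAdd, Nat.add_sub_cancel' hrN.le, Nat.mod_self])
  rw [(isCovariant_insertVec l X N A).corr_eq (isCovariant_insertVec l Y N A) hshift,
    dotProduct_insertVec A X Y hrl (by simp only; lia),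
    ← mixedTransfer_insertWord_add A X Y le_rfl (by lia), Nat.add_sub_cancel' hrl]

/-- The thermodynamic limit of the disconnected part of the overlap of the matrix-product states
with insertions `X` and `Y` on `l` sites, at large distance. -/
def disconnectedPart : ℂ :=
  R.contract R.top (mixedTransfer l X (word A)) R.top *
    R.contract R.top (mixedTransfer l (word A) Y) R.top

/-- The connected overlap of the insertion `X` with the insertion `Y` shifted to the right by `r`
sites, on the infinite chain. -/
def connectedRight (r : ℕ) : ℂ :=
  R.contract R.top (mixedTransfer (r + l) (insertWord A 0 l X) (insertWord A r l Y)) R.top -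
    disconnectedPart R l X Y

/-- The connected overlap of the insertion `X` with the insertion `Y` shifted to the left by
`r + 1` sites, on the infinite chain. -/
def connectedLeft (r : ℕ) : ℂ :=
  R.contract R.top
      (mixedTransfer (r + 1 + l) (insertWord A (r + 1) l X) (insertWord A 0 l Y)) R.top -
    disconnectedPart R l X Y

/-- The overlap per site of the Fourier superpositions of the insertions `X` and `Y` on `l` sites,
in the thermodynamic limit at the momentum `k` given by `z = exp (i k)`. -/
def structureFactor (z : Circle) : ℂ :=
  lineSum (connectedRight R l X Y) (connectedLeft R l X Y) z

theorem exists_norm_corr_right_sub_le : ∃ C : ℝ, 0 ≤ C ∧ ∀ N r, l ≤ r → r < N → r + l ≤ N →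
    ‖corr (insertVec N l A X) (insertVec N l A Y) r - disconnectedPart R l X Y‖ ≤
      C * (R.decayRate ^ (r - l) + R.decayRate ^ (N - (r + l))) := by
  obtain ⟨C, hC, hle⟩ := R.exists_norm_trace_sub_le (mixedTransfer l X (word A))
    (mixedTransfer l (word A) Y)
  refine ⟨C, hC, fun N r hlr hr hrl => ?_⟩
  obtain ⟨a, rfl⟩ := Nat.exists_eq_add_of_le hlr
  rw [corr_insertVec_right l X Y hr hrl, mixedTransfer_insertWord_right, Nat.add_sub_cancel_left]
  exact hle _ _

theorem exists_norm_corr_left_sub_le :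
    ∃ C : ℝ, 0 ≤ C ∧ ∀ N r, l ≤ r → 0 < r → r < N → r + l ≤ N →
      ‖corr (insertVec N l A X) (insertVec N l A Y) (N - r) - disconnectedPart R l X Y‖ ≤
        C * (R.decayRate ^ (r - l) + R.decayRate ^ (N - (r + l))) := by
  obtain ⟨C, hC, hle⟩ := R.exists_norm_trace_sub_le (mixedTransfer l (word A) Y)
    (mixedTransfer l X (word A))
  refine ⟨C, hC, fun N r hlr hr hrN hrl => ?_⟩
  obtain ⟨a, rfl⟩ := Nat.exists_eq_add_of_le hlr
  rw [corr_insertVec_left l X Y hr hrN hrl, mixedTransfer_insertWord_left,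
    Nat.add_sub_cancel_left, disconnectedPart, mul_comm (R.contract _ _ _)]
  exact hle _ _

theorem clusters_corr_insertVec :
    Clusters (fun N r => corr (insertVec N l A X) (insertVec N l A Y) r - disconnectedPart R l X Y)
      (connectedRight R l X Y) (connectedLeft R l X Y) where
  tendsto_right r := by
    refine Tendsto.sub_const ?_ _
    refine ((R.tendsto_trace_mul_pow _).comp (tendsto_sub_atTop_nat (r + l))).congr' ?_
    filter_upwards [eventually_ge_atTop (r + l + 1)] with N hN
    exact (corr_insertVec_right l X Y (by lia) (by lia)).symm
  tendsto_left r := by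
    refine Tendsto.sub_const ?_ _
    refine ((R.tendsto_trace_mul_pow _).comp (tendsto_sub_atTop_nat (r + 1 + l))).congr' ?_
    filter_upwards [eventually_ge_atTop (r + 1 + l + 1)] with N hN
    exact (corr_insertVec_left l X Y (by lia) (by lia) (by lia)).symm
  exists_bound := by
    obtain ⟨C₁, hC₁, hright⟩ := exists_norm_corr_right_sub_le R l X Y
    obtain ⟨C₂, hC₂, hleft⟩ := exists_norm_corr_left_sub_le R l X Y
    have hρ := R.decayRate_nonneg
    have hgeom : Summable fun r => R.decayRate ^ (r - l) := by
      rw [← summable_nat_add_iff l]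
      simpa only [Nat.add_sub_cancel] using summable_geometric_of_lt_one hρ R.decayRate_lt_one
    have hpow : ∀ {a b}, a ≤ b → R.decayRate ^ b ≤ R.decayRate ^ a :=
      pow_le_pow_of_le_one hρ R.decayRate_lt_one.le
    have hbound : ∀ {C a b r}, 0 ≤ C → C ≤ C₁ + C₂ → r ≤ a → r ≤ b →
        C * (R.decayRate ^ a + R.decayRate ^ b) ≤ (C₁ + C₂) * 2 * R.decayRate ^ r :=
      fun {C a b r} hC hC' ha hb => calc
        _ ≤ C * (R.decayRate ^ r + R.decayRate ^ r) := by gcongr C * (?_ + ?_) <;> exact hpow ‹_›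
        _ = C * 2 * R.decayRate ^ r := by ring
        _ ≤ _ := by gcongr
    refine ⟨_, hgeom.mul_left ((C₁ + C₂) * 2), l + 1, fun N r hlr hrN => ⟨?_, ?_⟩⟩
    · exact (hright N r (by lia) (by lia) (by lia)).trans
        (hbound hC₁ (le_add_of_nonneg_right hC₂) le_rfl (by lia))
    · exact (hleft N (r + 1) (by lia) (by lia) (by lia) (by lia)).trans
        (hbound hC₂ (le_add_of_nonneg_left hC₁) (by lia) (by lia))

theorem continuous_structureFactor : Continuous (structureFactor R l X Y) :=
  (clusters_corr_insertVec R l X Y).continuous_lineSum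

theorem tendsto_dotProduct_fourierVec_insertVec {ζ : ℕ → Circle} {z : Circle}
    (hζ : ∀ᶠ N in atTop, ζ N ^ N = 1)
    (hζ' : ∀ᶠ N in atTop, ζ N = 1 → disconnectedPart R l X Y = 0) (hz : Tendsto ζ atTop (𝓝 z)) :
    Tendsto (fun N => (star (fourierVec (ζ N) (insertVec N l A X)) ⬝ᵥ
      fourierVec (ζ N) (insertVec N l A Y)) / N) atTop (𝓝 (structureFactor R l X Y z)) := by
  refine ((clusters_corr_insertVec R l X Y).tendsto_sum hζ hz).congr' ?_
  filter_upwards [hζ, hζ', eventually_ne_atTop 0] with N hN hN' hN0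
  rw [dotProduct_fourierVec _ _ hN, mul_div_cancel_left₀ _ (Nat.cast_ne_zero.2 hN0)]
  simp only [mul_sub, Finset.sum_sub_distrib, ← Finset.sum_mul]
  rw [sub_eq_self]
  by_cases hone : ζ N = 1
  · rw [hN' hone, mul_zero]
  · have hne : (ζ N : ℂ) ≠ 1 := mt Circle.coe_eq_one.1 hone
    rw [geom_sum_eq hne, ← Circle.coe_pow, hN, Circle.coe_one, sub_self, zero_div, zero_mul]

theorem mpsVec_eq_insertVec_word {N : ℕ} (i : Fin N) :
    mpsVec N A = insertVec N l A (word A) i := by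
  funext s
  rw [mpsVec, insertVec, insertWord, List.take_zero, word_nil, one_mul, List.drop_zero, zero_add,
    ← word_append, List.take_append_drop, trace_word_rotate]

theorem dotProduct_mpsVec_insertVec {N : ℕ} (h : l ≤ N) (i : Fin N) :
    star (mpsVec N A) ⬝ᵥ insertVec N l A Y i =
      (mixedTransfer l (word A) Y * transfer A A ^ (N - l)).trace := by
  have hi : siteAdd i 0 = i := siteAdd_eq_of_add_eq (add_zero _)
  rw [mpsVec_eq_insertVec_word l i, ← (isCovariant_insertVec l (word A) N A).corr_eq
    (isCovariant_insertVec l Y N A) hi, corr_insertVec_right l _ _ i.pos (by lia), zero_add,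
    mixedTransfer_insertWord_zero]

theorem disconnectedPart_eq_zero
    (horth : ∀ᶠ N in atTop, ∀ i, star (mpsVec N A) ⬝ᵥ insertVec N l A Y i = 0) :
    disconnectedPart R l X Y = 0 := by
  have hmean : R.contract R.top (mixedTransfer l (word A) Y) R.top = 0 := by
    refine tendsto_nhds_unique_of_eventuallyEq
      ((R.tendsto_trace_mul_pow _).comp (tendsto_sub_atTop_nat l)) tendsto_const_nhds ?_
    filter_upwards [horth, eventually_ge_atTop (l + 1)] with N hN hlN
    exact (dotProduct_mpsVec_insertVec l Y (by lia) ⟨0, by lia⟩).symm.trans (hN _)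
  rw [disconnectedPart, hmean, mul_zero]

theorem structureFactor_one_eq_zero
    (horth : ∀ᶠ N in atTop, ∀ i, star (mpsVec N A) ⬝ᵥ insertVec N l A Y i = 0)
    (hzero : ∀ᶠ N in atTop, fourierVec 1 (insertVec N l A Y) = 0) :
    structureFactor R l X Y 1 = 0 := by
  refine tendsto_nhds_unique_of_eventuallyEq
    (tendsto_dotProduct_fourierVec_insertVec R l X Y (Eventually.of_forall fun _ => one_pow _)
      (Eventually.of_forall fun _ _ => disconnectedPart_eq_zero R l X Y horth)
      tendsto_const_nhds) tendsto_const_nhds ?_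
  filter_upwards [hzero] with N hN
  rw [hN, dotProduct_zero, zero_div]

variable (B : Fin d → Matrix (Fin χ) (Fin χ) ℂ)

theorem connectedRight_site_zero :
    connectedRight R 1 (word B) (word B) 0 = R.contract R.top (transfer B B) R.top -
      R.contract R.top (transfer B A) R.top * R.contract R.top (transfer A B) R.top := by
  rw [connectedRight, zero_add, mixedTransfer_insertWord_zero, disconnectedPart]
  simp only [mixedTransfer_one_word]

theorem connectedRight_site_succ (r : ℕ) :
    connectedRight R 1 (word B) (word B) (r + 1) =
      R.contract R.top (transfer B A * transfer A A ^ r * transfer A B) R.top -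
        R.contract R.top (transfer B A) R.top * R.contract R.top (transfer A B) R.top := by
  rw [connectedRight, add_comm r, mixedTransfer_insertWord_right, disconnectedPart]
  simp only [mixedTransfer_one_word]

theorem connectedLeft_site (r : ℕ) :
    connectedLeft R 1 (word B) (word B) r =
      R.contract R.top (transfer A B * transfer A A ^ r * transfer B A) R.top -
        R.contract R.top (transfer A B) R.top * R.contract R.top (transfer B A) R.top := by
  rw [connectedLeft, add_comm r, mixedTransfer_insertWord_left, disconnectedPart, mul_comm]
  simp only [mixedTransfer_one_word]

theorem structureFactor_site_eq_normDensitySq (k : ℝ) :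
    structureFactor R 1 (word B) (word B) (Circle.exp k) = normDensitySq A B R k := by
  have hright := R.hasSum_contract_mul_pow_mul_sub (transfer B A) (transfer A B)
    (w := (Circle.exp k : ℂ)) (Circle.norm_coe _)
  have hleft := R.hasSum_contract_mul_pow_mul_sub (transfer A B) (transfer B A)
    (w := ((Circle.exp k)⁻¹ : Circle)) (Circle.norm_coe _)
  simp only [← connectedRight_site_succ] at hright
  simp only [← connectedLeft_site] at hleft
  have hexp : (Circle.exp k : ℂ) = Complex.exp (Complex.I * k) := by
    rw [Circle.coe_exp, mul_comm]
  have hzero : HasSum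
      (fun r => (Circle.exp k : ℂ) ^ r * connectedRight R 1 (word B) (word B) r) _ :=
    hright.zero_add
  rw [structureFactor, lineSum, hzero.tsum_eq, hleft.tsum_eq, pow_zero, one_mul,
    connectedRight_site_zero, normDensitySq, Finset.sum_add_distrib, add_assoc, Circle.coe_inv,
    inv_inv, hexp, Complex.exp_neg]

end StructureFactor

section OperatorInsertions

variable {χ d L : ℕ} (A : Fin d → Matrix (Fin χ) (Fin χ) ℂ)

/-- The block of bond matrices which results from acting with an operator `Z` on `L` consecutive
sites of a matrix-product state; it is only meaningful on lists of length `L`. -/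
def opInsertion (Z : Matrix (Fin L → Fin d) (Fin L → Fin d) ℂ) :
    List (Fin d) → Matrix (Fin χ) (Fin χ) ℂ :=
  Function.extend List.ofFn (fun u => ∑ t, Z u t • word A (List.ofFn t)) 0

theorem opInsertion_ofFn (Z : Matrix (Fin L → Fin d) (Fin L → Fin d) ℂ) (u : Fin L → Fin d) :
    opInsertion A Z (List.ofFn u) = ∑ t, Z u t • word A (List.ofFn t) :=
  List.ofFn_injective.extend_apply _ _ u

theorem rotate_ofFn_eq_append {α : Type*} {N : ℕ} (hL : L ≤ N) (s : Fin N → α) (i : Fin N) :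
    (List.ofFn s).rotate i = List.ofFn (fun a : Fin L => s (siteAdd i a)) ++
      List.ofFn fun b : Fin (N - L) => s (siteAdd i (L + b)) := by
  refine List.ext_getElem (by simp; lia) fun x _ _ => ?_
  rw [List.getElem_append]
  split_ifs with hx
  · simp [List.getElem_rotate, siteAdd, add_comm x]
  · simp only [List.length_ofFn, not_lt] at hx
    simp [List.getElem_rotate, siteAdd, Nat.add_sub_cancel' hx, add_comm x]

theorem siteAdd_ne_siteAdd_of_lt {N a b : ℕ} (i : Fin N) (hab : a < b) (hb : b < a + N) :
    siteAdd i a ≠ siteAdd i b := by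
  intro h
  have hmod : a ≡ b [MOD N] := Nat.ModEq.add_left_cancel' i.val (congrArg Fin.val h)
  exact absurd (Nat.le_of_dvd (by lia) ((Nat.modEq_iff_dvd' hab.le).1 hmod)) (by lia)

theorem localOp_mulVec_mpsVec {N : ℕ} (hL : L ≤ N) (i : Fin N)
    (Z : Matrix (Fin L → Fin d) (Fin L → Fin d) ℂ) :
    localOp (fun a : Fin L => siteAdd i a) Z *ᵥ mpsVec N A =
      insertVec N L A (opInsertion A Z) i := by
  have hw := window_injective hL i
  funext s
  let v := List.ofFn fun b : Fin (N - L) => s (siteAdd i (L + b))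
  have hmps : ∀ t : Fin L → Fin d, mpsVec N A (Function.extend (fun a : Fin L => siteAdd i a) t s) =
      (word A (List.ofFn t) * word A v).trace := fun t => by
    have hout : ∀ b : Fin (N - L), Function.extend (fun a : Fin L => siteAdd i a) t s
        (siteAdd i (L + b)) = s (siteAdd i (L + b)) := fun b =>
      Function.extend_apply' _ _ _ fun ⟨a, ha⟩ =>
        siteAdd_ne_siteAdd_of_lt i (by lia) (by lia) ha
    rw [mpsVec, ← trace_word_rotate A _ i, rotate_ofFn_eq_append hL, word_append]
    simp only [hw.extend_apply, hout, v]
  rw [localOp_mulVec_apply hw, insertVec, rotate_ofFn_eq_append hL,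
    insertWord_append_word A _ (by simp), insertWord_of_length A _ List.length_ofFn,
    opInsertion_ofFn, Finset.sum_mul, Matrix.trace_sum]
  refine Finset.sum_congr rfl fun t _ => ?_
  rw [hmps, smul_mul_assoc, Matrix.trace_smul, smul_eq_mul]
  rfl

theorem insertVec_congr {Y Z : List (Fin d) → Matrix (Fin χ) (Fin χ) ℂ} {N : ℕ} (hL : L ≤ N)
    (hYZ : ∀ u : Fin L → Fin d, Y (List.ofFn u) = Z (List.ofFn u)) (i : Fin N) :
    insertVec N L A Y i = insertVec N L A Z i := by
  funext s
  rw [insertVec, insertVec, rotate_ofFn_eq_append hL, insertWord_append_word A _ (by simp),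
    insertWord_append_word A _ (by simp), insertWord_of_length A _ List.length_ofFn,
    insertWord_of_length A _ List.length_ofFn, hYZ]

variable {A}

theorem IsInjectiveMPS.exists_localOp_mulVec_eq_siteVec (hinj : IsInjectiveMPS A)
    (B : Fin d → Matrix (Fin χ) (Fin χ) ℂ) :
    ∃ (L : ℕ) (O : Matrix (Fin L → Fin d) (Fin L → Fin d) ℂ), ∀ N, L ≤ N → ∀ i : Fin N,
      localOp (fun a : Fin L => siteAdd i a) O *ᵥ mpsVec N A = siteVec N A B i := by
  obtain ⟨L, hL, hspan⟩ := hinj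
  have hcoeff : ∀ u : Fin L → Fin d, ∃ c : (Fin L → Fin d) → ℂ,
      ∑ t, c t • word A (List.ofFn t) = insertWord A 0 1 (word B) (List.ofFn u) := fun u => by
    refine (Submodule.mem_span_range_iff_exists_fun ℂ).1 ?_
    simp only [word, List.map_ofFn, Function.comp_def, hspan, Submodule.mem_top]
  choose O hO using hcoeff
  refine ⟨L, Matrix.of O, fun N hN i => ?_⟩
  rw [localOp_mulVec_mpsVec A hN, siteVec, insertVec_eq_insertVec_insertWord A _ hL hN]
  exact insertVec_congr A hN (fun u => (opInsertion_ofFn A _ u).trans (hO u)) i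

end OperatorInsertions

section LocalCommutator

variable {d L m : ℕ}

/-- The embedding of a window of `L` sites into a larger one, starting at site `m`. -/
def subWindow {L M : ℕ} (m : ℕ) (hm : m + L ≤ M) (a : Fin L) : Fin M :=
  ⟨m + a, by lia⟩

theorem subWindow_injective {M : ℕ} (hm : m + L ≤ M) : Function.Injective (subWindow m hm) :=
  fun _ _ hab => Fin.ext (Nat.add_left_cancel (congrArg Fin.val hab))

theorem siteAdd_comp_subWindow {M N : ℕ} (hm : m + L ≤ M) (j : Fin N) :
    (fun a : Fin M => siteAdd j a) ∘ subWindow m hm = fun a : Fin L => siteAdd (siteAdd j m) a :=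
  funext fun a => (siteAdd_siteAdd j m a).symm

/-- The operator `O`, seen as an operator on a window with `m` more sites on both sides. -/
def padOp (m : ℕ) (O : Matrix (Fin L → Fin d) (Fin L → Fin d) ℂ) :
    Matrix (Fin (m + L + m) → Fin d) (Fin (m + L + m) → Fin d) ℂ :=
  localOp (subWindow m (Nat.le_add_right _ _)) O

/-- The commutator of the Hamiltonian with a local operator `O`, as a local operator: it involves
only those terms `h` of the Hamiltonian whose support meets that of `O`. -/
def localCommutator (h : Matrix (Fin (m + 1) → Fin d) (Fin (m + 1) → Fin d) ℂ)
    (O : Matrix (Fin L → Fin d) (Fin L → Fin d) ℂ) :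
    Matrix (Fin (m + L + m) → Fin d) (Fin (m + L + m) → Fin d) ℂ :=
  ∑ a : Fin (m + L), (localOp (subWindow a.val (by lia)) h * padOp m O -
    padOp m O * localOp (subWindow a.val (by lia)) h)

variable (h : Matrix (Fin (m + 1) → Fin d) (Fin (m + 1) → Fin d) ℂ)
  (O : Matrix (Fin L → Fin d) (Fin L → Fin d) ℂ) {N : ℕ}

theorem localOp_padOp_mulVec (hN : m + L + m ≤ N) (j : Fin N) (v : (Fin N → Fin d) → ℂ) :
    localOp (fun a : Fin (m + L + m) => siteAdd j a) (padOp m O) *ᵥ v =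
      localOp (fun a : Fin L => siteAdd (siteAdd j m) a) O *ᵥ v := by
  rw [padOp, localOp_localOp_mulVec (subWindow_injective _) (window_injective hN j),
    siteAdd_comp_subWindow]

theorem localOp_localCommutator_mulVec (hN : m + L + m ≤ N) (j : Fin N)
    (v : (Fin N → Fin d) → ℂ) :
    localOp (fun a : Fin (m + L + m) => siteAdd j a) (localCommutator h O) *ᵥ v =
      ∑ a : Fin (m + L),
        (blockOp N h (siteAdd j a) *ᵥ (localOp (fun b : Fin L => siteAdd (siteAdd j m) b) O *ᵥ v) -
          localOp (fun b : Fin L => siteAdd (siteAdd j m) b) O *ᵥ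
            (blockOp N h (siteAdd j a) *ᵥ v)) := by
  have hw := window_injective hN j
  have hblock : ∀ (a : Fin (m + L)) (w : (Fin N → Fin d) → ℂ),
      localOp (fun b : Fin (m + L + m) => siteAdd j b)
        (localOp (subWindow a.val (by lia)) h) *ᵥ w = blockOp N h (siteAdd j a) *ᵥ w :=
    fun a w => by
    rw [localOp_localOp_mulVec (subWindow_injective _) hw, siteAdd_comp_subWindow,
      blockOp_eq_localOp]
  simp only [localCommutator, localOp_sum, Matrix.sum_mulVec, localOp_sub, Matrix.sub_mulVec,
    localOp_mul_mulVec hw, hblock, localOp_padOp_mulVec O hN]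

theorem blockOp_mulVec_comm (hN : m + L + m ≤ N) (j : Fin N) {b : ℕ} (hb : m + L ≤ b)
    (hbN : b < N) (v : (Fin N → Fin d) → ℂ) :
    blockOp N h (siteAdd j b) *ᵥ (localOp (fun a : Fin L => siteAdd (siteAdd j m) a) O *ᵥ v) =
      localOp (fun a : Fin L => siteAdd (siteAdd j m) a) O *ᵥ
        (blockOp N h (siteAdd j b) *ᵥ v) := by
  rw [blockOp_eq_localOp]
  refine localOp_mulVec_comm (window_injective (by lia) _) (window_injective (by lia) _)
    (fun a c => ?_) _ _ _
  rw [siteAdd_siteAdd, siteAdd_siteAdd]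
  exact (siteAdd_ne_siteAdd_of_lt j (by lia) (by lia)).symm

theorem localOp_localCommutator_mulVec_eq_hamiltonian (hN : m + L + m ≤ N) (j : Fin N)
    (v : (Fin N → Fin d) → ℂ) :
    localOp (fun a : Fin (m + L + m) => siteAdd j a) (localCommutator h O) *ᵥ v =
      hamiltonian N h *ᵥ (localOp (fun a : Fin L => siteAdd (siteAdd j m) a) O *ᵥ v) -
        localOp (fun a : Fin L => siteAdd (siteAdd j m) a) O *ᵥ (hamiltonian N h *ᵥ v) := by
  rw [localOp_localCommutator_mulVec h O hN, hamiltonian, ← sum_siteAdd_window (blockOp N h) j,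
    Matrix.sum_mulVec, Matrix.sum_mulVec, Matrix.mulVec_sum, ← Finset.sum_sub_distrib]
  refine Fintype.sum_of_injective (Fin.castLE (by lia)) (Fin.castLE_injective _) _ _
    (fun b hb => ?_) fun a => rfl
  have hb' : m + L ≤ b := not_lt.1 fun hlt => hb ⟨⟨b, hlt⟩, rfl⟩
  rw [sub_eq_zero, blockOp_mulVec_comm h O hN j hb' b.isLt]

end LocalCommutator

section ProductStates

variable {χ d p N : ℕ}

/-- The product state with vector `φ i` on site `i`. -/
def productVec (φ : Fin N → Fin p → ℂ) : (Fin N → Fin p) → ℂ :=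
  fun s => ∏ i, φ i (s i)

theorem productVec_update (φ : Fin N → Fin p → ℂ) (j : Fin N) (v : Fin p → ℂ)
    (s : Fin N → Fin p) :
    productVec (Function.update φ j v) s = v (s j) * ∏ i ∈ Finset.univ.erase j, φ i (s i) := by
  rw [productVec, ← Finset.mul_prod_erase _ _ (Finset.mem_univ j), Function.update_self]
  congr 1
  exact Finset.prod_congr rfl fun i hi => by rw [Function.update_of_ne (Finset.ne_of_mem_erase hi)]

theorem productVec_apply_update (φ : Fin N → Fin p → ℂ) (j : Fin N) (x : Fin p)
    (s : Fin N → Fin p) :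
    productVec φ (Function.update s j x) = φ j x * ∏ i ∈ Finset.univ.erase j, φ i (s i) := by
  rw [productVec, ← Finset.mul_prod_erase _ _ (Finset.mem_univ j), Function.update_self]
  congr 1
  exact Finset.prod_congr rfl fun i hi => by rw [Function.update_of_ne (Finset.ne_of_mem_erase hi)]

theorem siteOp_mulVec_productVec (q : Matrix (Fin p) (Fin p) ℂ) (φ : Fin N → Fin p → ℂ)
    (j : Fin N) :
    siteOp N q j *ᵥ productVec φ = productVec (Function.update φ j (q *ᵥ φ j)) := by
  have hextend : ∀ (t : Fin 1 → Fin p) (s : Fin N → Fin p),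
      Function.extend (fun _ : Fin 1 => j) t s = Function.update s j (t 0) := fun t s => by
    funext i
    rcases eq_or_ne i j with rfl | hi
    · rw [(Function.injective_of_subsingleton _).extend_apply t s 0, Function.update_self]
    · rw [Function.extend_apply' _ _ _ fun ⟨_, h⟩ => hi h.symm, Function.update_of_ne hi]
  funext s
  rw [siteOp_eq_localOp, localOp_mulVec_apply (Function.injective_of_subsingleton _),
    productVec_update, ← (Equiv.funUnique (Fin 1) (Fin p)).symm.sum_comp, Matrix.mulVec, dotProduct,
    Finset.sum_mul]
  refine Finset.sum_congr rfl fun x _ => ?_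
  rw [hextend, productVec_apply_update, mul_assoc]
  rfl

theorem onsiteAction_mulVec_productState (M : Matrix (Fin p) (Fin p) ℂ) (ψ : Fin p → ℂ) :
    onsiteAction N M *ᵥ productState N ψ = productState N (M *ᵥ ψ) := by
  funext s
  simp only [Matrix.mulVec, dotProduct, productState, onsiteAction, Matrix.of_apply,
    ← Finset.prod_mul_distrib]
  rw [Finset.prod_univ_sum, Fintype.piFinset_univ]

theorem sum_prod_smul_prod_ofFn (W : Fin d → Fin p → Matrix (Fin χ) (Fin χ) ℂ)
    (φ : Fin N → Fin p → ℂ) (l : Fin N → Fin d) :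
    ∑ s : Fin N → Fin p, (∏ i, φ i (s i)) • (List.ofFn fun i => W (l i) (s i)).prod =
      (List.ofFn fun i => mpsTensor W (φ i) (l i)).prod := by
  induction N with
  | zero => simp
  | succ n ih =>
    rw [← (Fin.consEquiv fun _ => Fin p).sum_comp, Fintype.sum_prod_type, List.ofFn_succ,
      List.prod_cons, ← ih, mpsTensor, Finset.sum_mul_sum]
    refine Finset.sum_congr rfl fun x _ => Finset.sum_congr rfl fun s _ => ?_
    simp [Fin.consEquiv, Fin.prod_univ_succ, List.ofFn_succ, smul_smul, mul_comm]

theorem mpo_mulVec_productVec (W : Fin d → Fin p → Matrix (Fin χ) (Fin χ) ℂ)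
    (φ : Fin N → Fin p → ℂ) (l : Fin N → Fin d) :
    (mpo N W *ᵥ productVec φ) l = (List.ofFn fun i => mpsTensor W (φ i) (l i)).prod.trace := by
  rw [← sum_prod_smul_prod_ofFn, Matrix.trace_sum, Matrix.mulVec, dotProduct]
  refine Finset.sum_congr rfl fun s _ => ?_
  rw [Matrix.trace_smul, smul_eq_mul, mul_comm]
  rfl

theorem mpo_mulVec_productState (N : ℕ) (W : Fin d → Fin p → Matrix (Fin χ) (Fin χ) ℂ)
    (ψ : Fin p → ℂ) : mpo N W *ᵥ productState N ψ = mpsVec N (mpsTensor W ψ) := by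
  funext l
  rw [mpsVec, word, List.map_ofFn]
  exact mpo_mulVec_productVec W (fun _ => ψ) l

theorem siteVec_apply (A B : Fin d → Matrix (Fin χ) (Fin χ) ℂ) (j : Fin N) (s : Fin N → Fin d) :
    siteVec N A B j s =
      (List.ofFn fun i => Function.update (fun _ => A) j B i (s i)).prod.trace := by
  have hset : (List.ofFn fun i => Function.update (fun _ => A) j B i (s i)) =
      ((List.ofFn s).map A).set j (B (s j)) := by
    refine List.ext_getElem (by simp) fun i hi _ => ?_
    rw [List.length_ofFn] at hi
    rw [List.getElem_set, List.getElem_ofFn]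
    split_ifs with hij
    · rw [show (⟨i, hi⟩ : Fin N) = j from Fin.ext hij.symm, Function.update_self]
    · rw [Function.update_of_ne fun h => hij (congrArg Fin.val h).symm, List.getElem_map,
        List.getElem_ofFn]
  rw [siteVec, insertVec_apply A _ j.isLt, insertWord, hset, List.prod_set, if_pos (by simp),
    word, word, word, List.map_take, List.map_drop]
  simp [List.take_one_drop_eq_of_lt_length]

theorem mpo_mulVec_siteOp_mulVec (W : Fin d → Fin p → Matrix (Fin χ) (Fin χ) ℂ)
    (q : Matrix (Fin p) (Fin p) ℂ) (ψ : Fin p → ℂ) (j : Fin N) :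
    mpo N W *ᵥ (siteOp N q j *ᵥ productState N ψ) =
      siteVec N (mpsTensor W ψ) (mpsTensor W (q *ᵥ ψ)) j := by
  funext l
  rw [siteVec_apply]
  refine (congrFun (congrArg (mpo N W *ᵥ ·) (siteOp_mulVec_productVec q (fun _ => ψ) j)) l).trans ?_
  simp only [mpo_mulVec_productVec, Function.apply_update fun _ => mpsTensor W]

theorem twistedVec_eq_fourierVec (N : ℕ) (W : Fin d → Fin p → Matrix (Fin χ) (Fin χ) ℂ)
    (ψ : Fin p → ℂ) (q : Matrix (Fin p) (Fin p) ℂ) (k : ℝ) :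
    twistedVec N W ψ q k =
      fourierVec (Circle.exp k) (siteVec N (mpsTensor W ψ) (mpsTensor W (q *ᵥ ψ))) := by
  refine Finset.sum_congr rfl fun j _ => ?_
  rw [mpo_mulVec_siteOp_mulVec, Circle.coe_exp, ← Complex.exp_nat_mul]
  ring_nf

end ProductStates

section DeformedSpace

variable {G : Type*} [Group G] {χ d p : ℕ} (N : ℕ) (W : Fin d → Fin p → Matrix (Fin χ) (Fin χ) ℂ)
  (U : G →* Matrix.unitaryGroup (Fin p) ℂ) (ψ : Fin p → ℂ)

/-- The derivative of the product state `v ⊗ ⋯ ⊗ v` at `v = ψ`. -/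
def productStateDeriv : (Fin p → ℂ) →ₗ[ℂ] ((Fin N → Fin p) → ℂ) where
  toFun φ := ∑ j, productVec (Function.update (fun _ => ψ) j φ)
  map_add' φ φ' := by
    rw [← Finset.sum_add_distrib]
    refine Finset.sum_congr rfl fun j _ => funext fun s => ?_
    simp only [Pi.add_apply, productVec_update, add_mul]
  map_smul' a φ := by
    rw [Finset.smul_sum]
    refine Finset.sum_congr rfl fun j _ => funext fun s => ?_
    simp only [Pi.smul_apply, productVec_update, smul_eq_mul, mul_assoc, RingHom.id_apply]

theorem hasDerivAt_productState {φ : ℝ → Fin p → ℂ} {φ' : Fin p → ℂ} {θ : ℝ}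
    (hφ : HasDerivAt φ φ' θ) :
    HasDerivAt (fun θ => productState N (φ θ)) (productStateDeriv N (φ θ) φ') θ := by
  refine hasDerivAt_pi.2 fun s => ?_
  refine (HasDerivAt.fun_finsetProd (u := Finset.univ)
    fun i _ => hasDerivAt_pi.1 hφ (s i)).congr_deriv ?_
  rw [productStateDeriv, LinearMap.coe_mk, AddHom.coe_mk, Finset.sum_apply]
  exact Finset.sum_congr rfl fun j _ => by rw [productVec_update, smul_eq_mul, mul_comm]

attribute [local instance] Matrix.linftyOpNormedRing Matrix.linftyOpNormedAlgebra in
theorem hasDerivAt_exp_mulVec (Q : Matrix (Fin p) (Fin p) ℂ) :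
    HasDerivAt (fun θ : ℝ => NormedSpace.exp ((Complex.I * θ) • Q) *ᵥ ψ)
      (Complex.I • (Q *ᵥ ψ)) 0 := by
  have hexp := hasDerivAt_exp_smul_const (𝕂 := ℝ) (Complex.I • Q) 0
  rw [zero_smul, NormedSpace.exp_zero, one_mul] at hexp
  have hscale : ∀ θ : ℝ, (Complex.I * θ) • Q = θ • Complex.I • Q := fun θ => by
    rw [mul_comm, mul_smul, Complex.coe_smul]
  simp only [hscale]
  rw [← Matrix.smul_mulVec]
  exact hasDerivAt_pi.2 fun i => HasDerivAt.fun_sum (u := Finset.univ) fun j _ =>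
    (hasDerivAt_pi.1 (hasDerivAt_pi.1 hexp i) j).mul_const (ψ j)

theorem mem_of_hasDerivAt {E : Type*} [NormedAddCommGroup E] [NormedSpace ℂ E]
    [FiniteDimensional ℂ E] {V : Submodule ℂ E} {c : ℝ → E} {c' : E} {x : ℝ}
    (hc : HasDerivAt c c' x) (hV : ∀ θ, c θ ∈ V) : c' ∈ V := by
  refine V.closed_of_finiteDimensional.mem_of_tendsto hc.tendsto_slope
    (Eventually.of_forall fun θ => ?_)
  rw [slope_def_module]
  exact (V.restrictScalars ℝ).smul_mem _ (V.sub_mem (hV θ) (hV x))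

theorem mpo_mulVec_productState_mem_deformedSpace (g : G) :
    mpo N W *ᵥ productState N ((U g : Matrix (Fin p) (Fin p) ℂ) *ᵥ ψ) ∈ deformedSpace N W U ψ := by
  rw [← onsiteAction_mulVec_productState]
  exact Submodule.subset_span ⟨g, rfl⟩

theorem mpsVec_mem_deformedSpace : mpsVec N (mpsTensor W ψ) ∈ deformedSpace N W U ψ := by
  have hone := mpo_mulVec_productState_mem_deformedSpace N W U ψ 1
  rwa [map_one, OneMemClass.coe_one, Matrix.one_mulVec, mpo_mulVec_productState] at hone

theorem mpo_mulVec_productStateDeriv_mem_deformedSpace {q : Matrix (Fin p) (Fin p) ℂ}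
    (hq : q ∈ complexLieAlgebra U) :
    mpo N W *ᵥ productStateDeriv N ψ (q *ᵥ ψ) ∈ deformedSpace N W U ψ := by
  let tangent := (mpo N W).mulVecLin ∘ₗ productStateDeriv N ψ ∘ₗ (Matrix.mulVecBilin ℂ ℂ).flip ψ
  suffices complexLieAlgebra U ≤ (deformedSpace N W U ψ).comap tangent from this hq
  refine Submodule.span_le.2 fun Q ⟨_, hQ⟩ => ?_
  have hcurve := hasDerivAt_productState N (hasDerivAt_exp_mulVec ψ Q)
  have hmem := mem_of_hasDerivAt (V := (deformedSpace N W U ψ).comap (mpo N W).mulVecLin) hcurve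
    fun θ => by
      obtain ⟨g, hg⟩ := hQ θ
      rw [← hg]
      exact mpo_mulVec_productState_mem_deformedSpace N W U ψ g
  rw [map_smul, Submodule.smul_mem_iff _ Complex.I_ne_zero] at hmem
  simpa [tangent] using hmem

theorem sum_siteVec_mem_deformedSpace {q : Matrix (Fin p) (Fin p) ℂ}
    (hq : q ∈ complexLieAlgebra U) :
    ∑ j, siteVec N (mpsTensor W ψ) (mpsTensor W (q *ᵥ ψ)) j ∈ deformedSpace N W U ψ := by
  have hsum : ∑ j, siteVec N (mpsTensor W ψ) (mpsTensor W (q *ᵥ ψ)) j =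
      mpo N W *ᵥ productStateDeriv N ψ (q *ᵥ ψ) := by
    simp only [← mpo_mulVec_siteOp_mulVec, ← Matrix.mulVec_sum]
    exact congrArg _ (Finset.sum_congr rfl fun j _ => siteOp_mulVec_productVec q (fun _ => ψ) j)
  exact hsum ▸ mpo_mulVec_productStateDeriv_mem_deformedSpace N W U ψ hq

end DeformedSpace

theorem isHermitian_hamiltonian {d m : ℕ} (N : ℕ)
    {h : Matrix (Fin (m + 1) → Fin d) (Fin (m + 1) → Fin d) ℂ} (hh : h.IsHermitian) :
    (hamiltonian N h).IsHermitian := by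
  refine isSelfAdjoint_sum _ fun i _ => ?_
  rw [blockOp_eq_localOp]
  exact isHermitian_localOp _ hh

section TwistedState

variable {χ d p : ℕ} (N : ℕ) (W : Fin d → Fin p → Matrix (Fin χ) (Fin χ) ℂ) (ψ : Fin p → ℂ)
  (q : Matrix (Fin p) (Fin p) ℂ) (k : ℝ)

theorem normalization_eq_vecNorm : normalization N W ψ q k =
    vecNorm (fourierVec (Circle.exp k) (siteVec N (mpsTensor W ψ) (mpsTensor W (q *ᵥ ψ)))) := by
  rw [normalization, twistedVec_eq_fourierVec, vecNorm]

theorem twistedState_eq_normalize : twistedState N W ψ q k =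
    normalize (fourierVec (Circle.exp k) (siteVec N (mpsTensor W ψ) (mpsTensor W (q *ᵥ ψ)))) := by
  rw [twistedState, normalization_eq_vecNorm, twistedVec_eq_fourierVec, normalize]

end TwistedState

section NormDensity

open scoped ComplexOrder

variable {χ d : ℕ} {A : Fin d → Matrix (Fin χ) (Fin χ) ℂ}
  (R : DominantResolution (transfer A A)) (B : Fin d → Matrix (Fin χ) (Fin χ) ℂ)

theorem continuous_normDensitySq : Continuous (normDensitySq A B R) :=
  ((continuous_structureFactor R 1 (word B) (word B)).comp Circle.exp.continuous).congr
    (structureFactor_site_eq_normDensitySq R B)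

theorem tendsto_dotProduct_fourierVec_siteVec {k : ℝ} {κ : ℕ → ℝ}
    (hκ : ∀ᶠ N in atTop, κ N ∈ momenta N) (hk : Tendsto κ atTop (𝓝 k)) :
    Tendsto (fun N => (star (fourierVec (Circle.exp (κ N)) (siteVec N A B)) ⬝ᵥ
      fourierVec (Circle.exp (κ N)) (siteVec N A B)) / N) atTop (𝓝 (normDensitySq A B R k)) := by
  rw [← structureFactor_site_eq_normDensitySq]
  exact tendsto_dotProduct_fourierVec_insertVec R 1 (word B) (word B)
    (eventually_circleExp_pow_eq_one hκ)
    ((eventually_circleExp_ne_one hκ).mono fun _ hne hone => absurd hone hne)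
    ((Circle.exp.continuous.tendsto k).comp hk)

theorem normDensitySq_nonneg (k : ℝ) : 0 ≤ normDensitySq A B R k := by
  obtain ⟨κ, hκ, hk⟩ := exists_momenta_tendsto k
  exact ge_of_tendsto' (tendsto_dotProduct_fourierVec_siteVec R B hκ hk) fun N =>
    div_nonneg (dotProduct_star_self_nonneg _) N.cast_nonneg

end NormDensity

section EnergyInsertions

variable {χ d m : ℕ} {A : Fin d → Matrix (Fin χ) (Fin χ) ℂ}
  {h : Matrix (Fin (m + 1) → Fin d) (Fin (m + 1) → Fin d) ℂ} {E : ℕ → ℝ}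

theorem residual_fourierVec {N : ℕ} {α : Type*} [Fintype α]
    (H : Matrix (Fin N → α) (Fin N → α) ℂ) (E : ℝ) (z : Circle) (V : Fin N → (Fin N → α) → ℂ) :
    residual H E (fourierVec z V) = fourierVec z fun j => residual H E (V j) := by
  simp only [residual, fourierVec, Matrix.mulVec_sum, Matrix.mulVec_smul, Finset.smul_sum, smul_sub,
    smul_comm (E : ℂ), Finset.sum_sub_distrib]

/-- The site insertion results from a local operator `O` acting on the matrix-product state, which
is an eigenstate of `H`; hence `(H - E) O |A⟩ = [H, O] |A⟩`, and `[H, O]` is local. -/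
theorem IsInjectiveMPS.exists_insertVec_eq (hinj : IsInjectiveMPS A)
    (B : Fin d → Matrix (Fin χ) (Fin χ) ℂ)
    (hE : ∀ᶠ N in atTop, hamiltonian N h *ᵥ mpsVec N A = (E N : ℂ) • mpsVec N A) :
    ∃ (M : ℕ) (X Y : List (Fin d) → Matrix (Fin χ) (Fin χ) ℂ), ∀ᶠ N in atTop,
      (insertVec N M A X = fun j => siteVec N A B (siteAdd j m)) ∧
      insertVec N M A Y = fun j =>
        residual (hamiltonian N h) (E N) (siteVec N A B (siteAdd j m)) := by
  obtain ⟨L, O, hO⟩ := hinj.exists_localOp_mulVec_eq_siteVec B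
  refine ⟨m + L + m, opInsertion A (padOp m O), opInsertion A (localCommutator h O), ?_⟩
  filter_upwards [hE, eventually_ge_atTop (m + L + m)] with N hEN hN
  refine ⟨funext fun j => ?_, funext fun j => ?_⟩
  · rw [← localOp_mulVec_mpsVec A hN, localOp_padOp_mulVec O hN, hO N (by lia)]
  · rw [← localOp_mulVec_mpsVec A hN, localOp_localCommutator_mulVec_eq_hamiltonian h O hN, hEN,
      Matrix.mulVec_smul, hO N (by lia), residual]

theorem IsInjectiveMPS.exists_energyStructureFactors (hinj : IsInjectiveMPS A)
    (R : DominantResolution (transfer A A)) (B : Fin d → Matrix (Fin χ) (Fin χ) ℂ)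
    (hh : h.IsHermitian)
    (hE : ∀ᶠ N in atTop, hamiltonian N h *ᵥ mpsVec N A = (E N : ℂ) • mpsVec N A)
    (hEsum : ∀ᶠ N in atTop,
      hamiltonian N h *ᵥ ∑ j, siteVec N A B j = (E N : ℂ) • ∑ j, siteVec N A B j) :
    ∃ F F' : Circle → ℂ, Continuous F ∧ Continuous F' ∧ F 1 = 0 ∧ F' 1 = 0 ∧
      ∀ (ζ : ℕ → Circle) (z : Circle), (∀ᶠ N in atTop, ζ N ^ N = 1) → (∀ᶠ N in atTop, ζ N ≠ 1) →
        Tendsto ζ atTop (𝓝 z) →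
        let v N := fourierVec (ζ N) (siteVec N A B)
        let r N := residual (hamiltonian N h) (E N) (v N)
        Tendsto (fun N => (star (v N) ⬝ᵥ r N) / N) atTop (𝓝 (F z)) ∧
          Tendsto (fun N => (star (r N) ⬝ᵥ r N) / N) atTop (𝓝 (F' z)) := by
  obtain ⟨M, X, Y, hXY⟩ := hinj.exists_insertVec_eq B hE
  have horth : ∀ᶠ N in atTop, ∀ i, star (mpsVec N A) ⬝ᵥ insertVec N M A Y i = 0 := by
    filter_upwards [hXY, hE] with N ⟨_, hY⟩ hEN i
    rw [hY]
    exact dotProduct_residual_eq_zero (isHermitian_hamiltonian N hh) hEN _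
  have hzero : ∀ᶠ N in atTop, fourierVec 1 (insertVec N M A Y) = 0 := by
    filter_upwards [hXY, hEsum] with N ⟨_, hY⟩ hEN
    rw [hY, ← residual_fourierVec, fourierVec_one, sum_siteAdd (siteVec N A B), residual, hEN,
      sub_self]
  refine ⟨structureFactor R M X Y, structureFactor R M Y Y, continuous_structureFactor R M X Y,
    continuous_structureFactor R M Y Y, structureFactor_one_eq_zero R M X Y horth hzero,
    structureFactor_one_eq_zero R M Y Y horth hzero, fun ζ z hζ hne hz => ?_⟩
  have hlim : ∀ Z, Tendsto (fun N => (star (fourierVec (ζ N) (insertVec N M A Z)) ⬝ᵥ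
      fourierVec (ζ N) (insertVec N M A Y)) / N) atTop (𝓝 (structureFactor R M Z Y z)) :=
    fun Z => tendsto_dotProduct_fourierVec_insertVec R M Z Y hζ
      (hne.mono fun _ hN hone => absurd hone hN) hz
  let ρ N j := residual (hamiltonian N h) (E N) (siteVec N A B j)
  refine ⟨(hlim X).congr' ?_, (hlim Y).congr' ?_⟩
  · filter_upwards [hXY, hζ] with N ⟨hX, hY⟩ hN
    rw [residual_fourierVec, hX, hY,
      dotProduct_fourierVec_comp_siteAdd (siteVec N A B) (ρ N) hN m]
  · filter_upwards [hXY, hζ] with N ⟨_, hY⟩ hN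
    rw [residual_fourierVec, hY, dotProduct_fourierVec_comp_siteAdd (ρ N) (ρ N) hN m]

end EnergyInsertions

theorem continuousOn_re_comp_exp_div {F : Circle → ℂ} {D : ℝ → ℂ} (hF : Continuous F)
    (hD : Continuous D) : ContinuousOn (fun k => (F (Circle.exp k) / D k).re) {k | D k ≠ 0} :=
  Complex.continuous_re.comp_continuousOn <|
    (hF.comp Circle.exp.continuous).continuousOn.div hD.continuousOn fun _ => id

end DeformedScar

end

section General

open DeformedScar
open scoped Matrix

theorem mainTheorem2_general {χ d m : ℕ} (A B : Fin d → Matrix (Fin χ) (Fin χ) ℂ)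
    (hinj : IsInjectiveMPS A) (R : DominantResolution (transfer A A))
    (h : Matrix (Fin (m + 1) → Fin d) (Fin (m + 1) → Fin d) ℂ) (hh : h.IsHermitian) (E₀ : ℕ → ℝ)
    (hE₀ : ∀ᶠ N in atTop, hamiltonian N h *ᵥ mpsVec N A = (E₀ N : ℂ) • mpsVec N A)
    (hE₀_sum : ∀ᶠ N in atTop,
      hamiltonian N h *ᵥ ∑ j, siteVec N A B j = (E₀ N : ℂ) • ∑ j, siteVec N A B j) :
    (Continuous (normDensitySq A B R) ∧
      (∀ k : ℝ, (normDensitySq A B R k).im = 0 ∧ 0 ≤ (normDensitySq A B R k).re) ∧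
      ∀ (k : ℝ) (κ : ℕ → ℝ), (∀ᶠ N in atTop, κ N ∈ momenta N) → Tendsto κ atTop (𝓝 k) →
        Tendsto (fun N => vecNorm (fourierVec (Circle.exp (κ N)) (siteVec N A B)) / Real.sqrt N)
          atTop (𝓝 (Real.sqrt (normDensitySq A B R k).re))) ∧
    ∃ ε δsq : ℝ → ℝ,
      ContinuousOn ε {k | normDensitySq A B R k ≠ 0} ∧
      ContinuousOn δsq {k | normDensitySq A B R k ≠ 0} ∧
      (∀ k : ℝ, normDensitySq A B R k ≠ 0 →
        ∀ κ : ℕ → ℝ, (∀ᶠ N in atTop, κ N ∈ momenta N) → Tendsto κ atTop (𝓝 k) →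
          Tendsto (fun N => expectation (hamiltonian N h)
            (normalize (fourierVec (Circle.exp (κ N)) (siteVec N A B))) - E₀ N) atTop (𝓝 (ε k)) ∧
          Tendsto (fun N => energyVariance (hamiltonian N h)
            (normalize (fourierVec (Circle.exp (κ N)) (siteVec N A B)))) atTop (𝓝 (δsq k))) ∧
      (normDensitySq A B R 0 ≠ 0 → Tendsto ε (𝓝 0) (𝓝 0) ∧ Tendsto δsq (𝓝 0) (𝓝 0)) := by
  have hD := continuous_normDensitySq R B
  refine ⟨⟨hD, fun k => (Complex.nonneg_iff.1 (normDensitySq_nonneg R B k)).symm.imp Eq.symm id,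
    fun _ _ hκ hk => tendsto_vecNorm_div_sqrt
      (tendsto_dotProduct_fourierVec_siteVec R B hκ hk)⟩, ?_⟩
  obtain ⟨F, F', hF, hF', hF_one, hF'_one, hlim⟩ :=
    hinj.exists_energyStructureFactors R B hh hE₀ hE₀_sum
  have hε := continuousOn_re_comp_exp_div hF hD
  have hδsq := (continuousOn_re_comp_exp_div hF' hD).sub (hε.pow 2)
  refine ⟨_, _, hε, hδsq, fun k hk κ hκ hκk => ?_, fun h0 => ?_⟩
  · have hv := tendsto_dotProduct_fourierVec_siteVec R B hκ hκk
    obtain ⟨hvr, hrr⟩ := hlim _ _ (eventually_circleExp_pow_eq_one hκ)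
      (eventually_circleExp_ne_one hκ) ((Circle.exp.continuous.tendsto k).comp hκk)
    exact ⟨tendsto_expectation_normalize_sub hv hk hvr,
      tendsto_energyVariance_normalize (isHermitian_hamiltonian · hh) hv hk hvr hrr⟩
  · have hmem := (isOpen_ne_fun hD continuous_const).mem_nhds h0
    exact ⟨by simpa [hF_one] using (hε.continuousAt hmem).tendsto, by
      simpa [hF_one, hF'_one] using (hδsq.continuousAt hmem).tendsto⟩

end General

theorem mainTheorem2
    {G : Type*} [Group G] {χ d p m : ℕ}
    (U : G →* Matrix.unitaryGroup (Fin p) ℂ)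
    (ψ : Fin p → ℂ)
    (q : Matrix (Fin p) (Fin p) ℂ) (hq : q ∈ DeformedScar.complexLieAlgebra U)
    (W : Fin d → Fin p → Matrix (Fin χ) (Fin χ) ℂ)
    (A B : Fin d → Matrix (Fin χ) (Fin χ) ℂ)
    (hA : A = DeformedScar.mpsTensor W ψ)
    (hB : B = DeformedScar.mpsTensor W (q.mulVec ψ))
    (hinj : DeformedScar.IsInjectiveMPS A)
    (R : DeformedScar.DominantResolution (DeformedScar.transfer A A))
    (h : Matrix (Fin (m + 1) → Fin d) (Fin (m + 1) → Fin d) ℂ) (hh : h.IsHermitian)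
    (E₀ : ℕ → ℝ)
    (hscar : ∀ N, m < N → ∀ v ∈ DeformedScar.deformedSpace N W U ψ,
      (DeformedScar.hamiltonian N h).mulVec v = (E₀ N : ℂ) • v) :
    -- the normalization is `√N` times a finite tensor contraction
    (Continuous (DeformedScar.normDensitySq A B R) ∧
      (∀ k : ℝ, (DeformedScar.normDensitySq A B R k).im = 0 ∧
        0 ≤ (DeformedScar.normDensitySq A B R k).re) ∧
      ∀ (k : ℝ) (κ : ℕ → ℝ), (∀ᶠ N in atTop, κ N ∈ DeformedScar.momenta N) →
        Tendsto κ atTop (𝓝 k) →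
        Tendsto (fun N => DeformedScar.normalization N W ψ q (κ N) / Real.sqrt N) atTop
          (𝓝 (Real.sqrt (DeformedScar.normDensitySq A B R k).re))) ∧
    -- energy and variance in the thermodynamic limit
    ∃ ε δsq : ℝ → ℝ,
      ContinuousOn ε {k | DeformedScar.normDensitySq A B R k ≠ 0} ∧
      ContinuousOn δsq {k | DeformedScar.normDensitySq A B R k ≠ 0} ∧
      (∀ k : ℝ, DeformedScar.normDensitySq A B R k ≠ 0 →
        ∀ κ : ℕ → ℝ, (∀ᶠ N in atTop, κ N ∈ DeformedScar.momenta N) →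
          Tendsto κ atTop (𝓝 k) →
          Tendsto (fun N => DeformedScar.expectation (DeformedScar.hamiltonian N h)
            (DeformedScar.twistedState N W ψ q (κ N)) - E₀ N) atTop (𝓝 (ε k)) ∧
          Tendsto (fun N => DeformedScar.energyVariance (DeformedScar.hamiltonian N h)
            (DeformedScar.twistedState N W ψ q (κ N))) atTop (𝓝 (δsq k))) ∧
      (DeformedScar.normDensitySq A B R 0 ≠ 0 →
        Tendsto ε (𝓝 0) (𝓝 0) ∧ Tendsto δsq (𝓝 0) (𝓝 0)) := by
  subst hA hB
  have hmps : ∀ᶠ N in atTop, (DeformedScar.hamiltonian N h).mulVec _ = (E₀ N : ℂ) • _ :=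
    (eventually_gt_atTop m).mono fun N hN =>
      hscar N hN _ (DeformedScar.mpsVec_mem_deformedSpace N W U ψ)
  have hsum : ∀ᶠ N in atTop, (DeformedScar.hamiltonian N h).mulVec _ = (E₀ N : ℂ) • _ :=
    (eventually_gt_atTop m).mono fun N hN =>
      hscar N hN _ (DeformedScar.sum_siteVec_mem_deformedSpace N W U ψ hq)
  simp only [DeformedScar.normalization_eq_vecNorm, DeformedScar.twistedState_eq_normalize]
  exact mainTheorem2_general _ _ hinj R h hh E₀ hmps hsum
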